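/- Let $G=\mathbb{C}^*$ act linearly (i.e. by an algebraic representation) on a finite-dimensional complex vector space $V$, with associated weight space decomposition $V=\bigoplus_{m\in\mathbb{Z}}V_m$, where $V_m=\{v\in V : t\cdot v=t^m v \text{ for all } t\in\mathbb{C}^*\}$. Let $$p\colon V\longrightarrow S:=V/\!/\mathbb{C}^*=\operatorname{Spec}\bigl(\operatorname{Sym}(V^*)^{\mathbb{C}^*}\bigr)$$ be the GIT quotient, put $s_0:=p(0)\in S$, and let $S^{\mathrm{sing}}\subseteq S$ denote the singular locus of $S$. Suppose that $V_{-1}$ and $V_1$ both have dimension $\geq 2$. Then: (i) The quotient $S$ is singular in $s_0$. (ii) Every neighbourhood $U$ of $s_0$ in the set of closed points of $S$, taken with the Euclidean topology, contains an open neighbourhood $U'\subseteq U$ of $s_0$ such that $U'\setminus S^{\mathrm{sing}}$ is connected and $\pi_1(U'\setminus S^{\mathrm{sing}})$ is trivial. -/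

import Mathlib

noncomputable section

namespace GITQuotient

/-! ### Linear actions of an abstract group and their affine quotients -/

section Quotient

variable {G V : Type*} [Group G] [AddCommGroup V] [Module ℂ V]

/-- The action of `g` on the algebra `Sym(V^*)` of polynomial functions on `V`: the algebra
endomorphism that extends the contragredient action `φ ↦ φ ∘ ρ(g⁻¹)` on the generators `V^*`. -/
def symAction (ρ : Representation ℂ G V) (g : G) :
    SymmetricAlgebra ℂ (Module.Dual ℂ V) →ₐ[ℂ] SymmetricAlgebra ℂ (Module.Dual ℂ V) :=
  SymmetricAlgebra.lift (SymmetricAlgebra.ι ℂ (Module.Dual ℂ V) ∘ₗ ρ.dual g)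

/-- The algebra of invariants `Sym(V^*)^G`, i.e. the coordinate ring of `V // G`. -/
def invariantRing (ρ : Representation ℂ G V) :
    Subalgebra ℂ (SymmetricAlgebra ℂ (Module.Dual ℂ V)) :=
  ⨅ g : G, AlgHom.equalizer (symAction ρ g) (AlgHom.id ℂ _)

/-- Evaluation of polynomial functions at a vector `v`. -/
def evalAt (v : V) : SymmetricAlgebra ℂ (Module.Dual ℂ V) →ₐ[ℂ] ℂ :=
  SymmetricAlgebra.lift (Module.Dual.eval ℂ V v)

end Quotient

/-! ### Complex points of an affine scheme over `ℂ` -/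

section Points

variable (A : Type*) [CommRing A] [Algebra ℂ A]

/-- The complex points of `Spec A`; if `A` is of finite type over `ℂ`, these are its closed
points. -/
def ComplexPoints : Type _ := A →ₐ[ℂ] ℂ

/-- The Euclidean topology: the coarsest topology for which every regular function is continuous.
If `A` is generated by `f₁, …, f_N`, this is the topology induced by the closed embedding
`(f₁, …, f_N)` into `ℂ^N`. -/
instance : TopologicalSpace (ComplexPoints A) :=
  TopologicalSpace.induced (fun (x : A →ₐ[ℂ] ℂ) (a : A) => x a) inferInstance

variable {A}

/-- The point of the underlying space of `Spec A` given by a complex point. -/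
def ComplexPoints.toPrimeSpectrum (x : ComplexPoints A) : PrimeSpectrum A :=
  ⟨RingHom.ker (show A →ₐ[ℂ] ℂ from x), RingHom.ker_isPrime _⟩

variable (A)

/-- The singular locus, as a set of complex points: the points at which the local ring of `Spec A`
is not regular. -/
def singularLocus : Set (ComplexPoints A) :=
  {x | ¬ IsRegularLocalRing (Localization.AtPrime x.toPrimeSpectrum.asIdeal)}

end Points

/-- The space of closed points of `V // G = Spec (Sym(V^*)^G)`, with the Euclidean topology. -/
abbrev AffineQuotient {G V : Type*} [Group G] [AddCommGroup V] [Module ℂ V]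
    (ρ : Representation ℂ G V) : Type _ :=
  ComplexPoints (invariantRing ρ)

/-- The quotient map `p : V → V // G`. -/
def quotientMap {G V : Type*} [Group G] [AddCommGroup V] [Module ℂ V]
    (ρ : Representation ℂ G V) (v : V) : AffineQuotient ρ :=
  (evalAt v).comp (invariantRing ρ).val

/-! ### Algebraic representations of `ℂ^*` -/

section Torus

variable {V : Type*} [AddCommGroup V] [Module ℂ V]

/-- A linear action of `ℂ^*` is algebraic if all its matrix coefficients are regular functions on
`ℂ^*`, i.e. Laurent polynomials. -/
def IsAlgebraicRep (ρ : Representation ℂ ℂˣ V) : Prop :=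
  ∀ (φ : Module.Dual ℂ V) (v : V), ∃ P : LaurentPolynomial ℂ, ∀ t : ℂˣ,
    φ (ρ t v) = LaurentPolynomial.eval₂ (RingHom.id ℂ) t P

/-- The weight space `V_m`, on which `t ∈ ℂ^*` acts as `t ^ m`. -/
def weightSpace (ρ : Representation ℂ ℂˣ V) (m : ℤ) : Submodule ℂ V :=
  ⨅ t : ℂˣ, LinearMap.eqLocus (ρ t) (((t ^ m : ℂˣ) : ℂ) • LinearMap.id)

end Torus

end GITQuotient

end

/-! In a basis of weight vectors, `S` is the quotient of `ℂ^σ` by the diagonal action of `ℂ^*` with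
weights `a i`. If the support of `v` contains weights of both signs, the orbit of `v` is closed
and its stabilizer is cyclic of order `k`, the greatest common divisor of the weights in the
support; all other points have the same image as a fixed point, for which `k = 0`.

If `k ≠ 1`, then `S` is singular at the image of `v`. Point derivations there come from the
invariant vector fields `X i ∂/∂X i` in the directions of the support and from the indecomposable
exponents on the remaining coordinates whose weight is divisible by `k`. With two coordinates of
weight `1` and two of weight `-1`, there are more independent ones than `dim S ≤ dim V - 1`. If
`k = 1`, then `v` is a free point: a local section of the quotient map shows that `S` is regular at
its image. In particular, the singular locus is the image of the non-free points, among which is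
`0`.

The non-free points form a finite union of coordinate subspaces of complex codimension at least two.
A neighbourhood of `s₀` defined by bounds on invariant monomials has a star-shaped preimage in
`ℂ^σ`, which remains simply connected when these subspaces, of real codimension at least three, are
removed. The quotient map from the free points is surjective onto the regular part, has local
sections, and its fibres are orbits and hence connected, so that simple connectedness descends. -/

noncomputable section

namespace GITQuotient

/-! ### Descent of simple connectedness -/

section Descent

open Topology unitInterval

variable {E B X : Type*} [TopologicalSpace E] [TopologicalSpace B]

/-- A map has local sections if every point of the base has a neighbourhood over which a continuous
section passes through any prescribed point of the total space. Principal bundles and coverings are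
the main examples; sections are total functions of which only the values on `O` matter. -/
def HasLocalSections (q : E → B) : Prop :=
  ∀ b : B, ∃ O ∈ 𝓝 b, ∀ e : E, q e ∈ O →
    ∃ s : B → E, ContinuousOn s O ∧ Set.RightInvOn s q O ∧ s (q e) = e

theorem continuousOn_ite_le [LinearOrder X] [TopologicalSpace X] [OrderClosedTopology X]
    {f g : X → E} {a b c : X} (hf : ContinuousOn f (Set.Icc a b))
    (hg : ContinuousOn g (Set.Icc b c)) (hfg : f b = g b) :
    ContinuousOn (fun x => if x ≤ b then f x else g x) (Set.Icc a c) := by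
  have hg' : Set.EqOn (fun x => if x ≤ b then f x else g x) g (Set.Icc b c) := by
    intro x hx
    rcases hx.1.eq_or_lt with rfl | hbx
    · simp [hfg]
    · simp [hbx.not_ge]
  refine ((hf.congr fun x hx => if_pos hx.2).union_of_isClosed (hg.congr hg')
    isClosed_Icc isClosed_Icc).mono fun x hx => ?_
  exact (le_total x b).imp (fun h => ⟨hx.1, h⟩) (fun h => ⟨h, hx.2⟩)

theorem exists_continuousOn_lift_Icc_extend [LinearOrder X] [TopologicalSpace X]
    [OrderClosedTopology X] {q : E → B} {O : Set B}
    (hsec : ∀ e : E, q e ∈ O →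
      ∃ s : B → E, ContinuousOn s O ∧ Set.RightInvOn s q O ∧ s (q e) = e)
    {γ : X → B} (hγ : Continuous γ) {a b c : X} (hab : a ≤ b) (hbc : b ≤ c)
    (hO : Set.MapsTo γ (Set.Icc b c) O) {Γ : X → E} (hΓ : ContinuousOn Γ (Set.Icc a b))
    (hqΓ : ∀ x ∈ Set.Icc a b, q (Γ x) = γ x) :
    ∃ Γ' : X → E, ContinuousOn Γ' (Set.Icc a c) ∧ Γ' a = Γ a ∧
      ∀ x ∈ Set.Icc a c, q (Γ' x) = γ x := by
  have hqb : q (Γ b) = γ b := hqΓ b ⟨hab, le_rfl⟩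
  obtain ⟨s, hs, hqs, hsb⟩ := hsec (Γ b) (hqb ▸ hO ⟨le_rfl, hbc⟩)
  refine ⟨fun x => if x ≤ b then Γ x else s (γ x),
    continuousOn_ite_le hΓ (hs.comp hγ.continuousOn hO) (by rw [← hqb, hsb]), if_pos hab,
    fun x hx => ?_⟩
  by_cases h : x ≤ b
  · simpa [h] using hqΓ x ⟨hx.1, h⟩
  · simpa [h] using hqs (hO ⟨(not_le.1 h).le, hx.2⟩)

theorem HasLocalSections.exists_lift {q : E → B} (hq : HasLocalSections q) (γ : C(I, B)) {e₀ : E}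
    (he₀ : q e₀ = γ 0) : ∃ Γ : C(I, E), Γ 0 = e₀ ∧ ∀ t, q (Γ t) = γ t := by
  choose O hO hsec using hq
  obtain ⟨t, ht0, htm, ⟨N, hN⟩, hsub⟩ := exists_monotone_Icc_subset_open_cover_unitInterval
    (c := fun b : B => γ ⁻¹' interior (O b)) (fun b => isOpen_interior.preimage γ.continuous)
    (fun x _ => Set.mem_iUnion.2 ⟨γ x, mem_interior_iff_mem_nhds.2 (hO _)⟩)
  have lift_to (n : ℕ) : ∃ Γ : I → E, ContinuousOn Γ (Set.Icc 0 (t n)) ∧ Γ 0 = e₀ ∧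
      ∀ x ∈ Set.Icc 0 (t n), q (Γ x) = γ x := by
    induction n with
    | zero => exact ⟨fun _ => e₀, continuousOn_const, rfl, by simp [ht0, he₀]⟩
    | succ n ih =>
      obtain ⟨Γ, hΓ, rfl, hqΓ⟩ := ih
      obtain ⟨b, hb⟩ := hsub n
      exact exists_continuousOn_lift_Icc_extend (hsec b) γ.continuous (t n).2.1 (htm n.le_succ)
        (fun x hx => interior_subset (hb hx)) hΓ hqΓ
  obtain ⟨Γ, hΓ, hΓ0, hqΓ⟩ := lift_to N
  have hI : Set.Icc 0 (t N) = Set.univ := by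
    rw [hN N le_rfl]
    exact Set.Icc_bot_top
  rw [hI] at hΓ hqΓ
  exact ⟨⟨Γ, continuousOn_univ.1 hΓ⟩, hΓ0, fun x => hqΓ x trivial⟩

theorem HasLocalSections.simplyConnectedSpace [SimplyConnectedSpace E] {q : E → B}
    (hsec : HasLocalSections q) (hq : Continuous q) (hsurj : Function.Surjective q)
    (hfib : ∀ e e' : E, q e = q e' → JoinedIn (q ⁻¹' {q e}) e e') : SimplyConnectedSpace B := by
  refine simply_connected_iff_paths_homotopic'.2
    ⟨hsurj.pathConnectedSpace hq, fun {x y} γ₁ γ₂ => ?_⟩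
  obtain ⟨e, rfl⟩ := hsurj x
  obtain ⟨Γ₁, h₁0, h₁⟩ := hsec.exists_lift γ₁.toContinuousMap (e₀ := e) (by simp)
  obtain ⟨Γ₂, h₂0, h₂⟩ := hsec.exists_lift γ₂.toContinuousMap (e₀ := e) (by simp)
  have hy₁ : q (Γ₁ 1) = y := by rw [h₁]; simp
  have hy₂ : q (Γ₂ 1) = y := by rw [h₂]; simp
  obtain ⟨β, hβ⟩ := hfib (Γ₁ 1) (Γ₂ 1) (by rw [hy₁, hy₂])
  -- The two lifts become homotopic once their ends are joined inside a fibre.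
  have hlift : (Path.mk Γ₁ h₁0 rfl |>.trans β).Homotopic (Path.mk Γ₂ h₂0 rfl) :=
    SimplyConnectedSpace.paths_homotopic _ _
  have hmap := (hlift.map ⟨q, hq⟩).pathCast rfl hy₂.symm
  have hγ₂ : ((Path.mk Γ₂ h₂0 rfl).map hq).cast rfl hy₂.symm = γ₂ := by ext t; exact h₂ t
  have hγ₁ : ((Path.mk Γ₁ h₁0 rfl |>.trans β).map hq).cast rfl hy₂.symm
      = γ₁.trans (Path.refl y) := by
    rw [Path.map_trans]
    ext t
    simp only [Path.cast_coe, Path.trans_apply, Path.map_coe, Function.comp_apply]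
    split_ifs
    · exact h₁ _
    · exact (hβ _).trans hy₁
  have htrans : (γ₁.trans (Path.refl y)).Homotopic γ₁ := ⟨Path.Homotopy.transRefl γ₁⟩
  rw [← hγ₁] at htrans
  rw [← hγ₂]
  exact htrans.symm.trans hmap

end Descent

/-! ### Complements of subspaces of real codimension at least three -/

section Homotopy

open Topology unitInterval

variable {X Y : Type*} [TopologicalSpace X] [TopologicalSpace Y]

theorem homotopic_of_eq_along_path [SimplyConnectedSpace X] {f g : X → Y} (hf : Continuous f)
    (hg : Continuous g) {a b : X} {β₀ : Path a b} (hβ₀ : ∀ t, f (β₀ t) = g (β₀ t)) (β : Path a b)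
    {x y : Y} {γ₁ γ₂ : Path x y} (h₁ : ∀ t, f (β t) = γ₁ t) (h₂ : ∀ t, g (β t) = γ₂ t) :
    γ₁.Homotopic γ₂ := by
  obtain rfl : f a = x := by simpa using h₁ 0
  obtain rfl : f b = y := by simpa using h₁ 1
  have hβ : β.Homotopic β₀ := SimplyConnectedSpace.paths_homotopic β β₀
  have ha : f a = g a := by simpa using hβ₀ 0
  have hb : f b = g b := by simpa using hβ₀ 1
  have e₁ : β.map hf = γ₁ := by ext t; exact h₁ t
  have e₂ : (β.map hg).cast ha hb = γ₂ := by ext t; exact h₂ t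
  have e₀ : β₀.map hf = (β₀.map hg).cast ha hb := by ext t; exact hβ₀ t
  rw [← e₁, ← e₂]
  exact (hβ.map ⟨f, hf⟩).trans (e₀ ▸ (hβ.symm.map ⟨g, hg⟩).pathCast ha hb)

theorem joinedIn_unitSquare_three_sides :
    JoinedIn {p : I × I | p.1 = 0 ∨ p.1 = 1 ∨ p.2 = 1} (0, 0) (1, 0) := by
  let id : Path (0 : I) 1 := ⟨.id I, rfl, rfl⟩
  have left : JoinedIn {p : I × I | p.1 = 0 ∨ p.1 = 1 ∨ p.2 = 1} (0, 0) (0, 1) :=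
    ⟨id.map (f := fun s => (0, s)) (by fun_prop), fun _ => Or.inl rfl⟩
  have top : JoinedIn {p : I × I | p.1 = 0 ∨ p.1 = 1 ∨ p.2 = 1} (0, 1) (1, 1) :=
    ⟨id.map (f := fun t => (t, 1)) (by fun_prop), fun _ => Or.inr (Or.inr rfl)⟩
  have right : JoinedIn {p : I × I | p.1 = 0 ∨ p.1 = 1 ∨ p.2 = 1} (1, 0) (1, 1) :=
    ⟨id.map (f := fun s => (1, s)) (by fun_prop), fun _ => Or.inr (Or.inl rfl)⟩
  exact (left.trans top).trans right.symm

variable {F : Type*} [AddCommGroup F] [Module ℝ F] [TopologicalSpace F] [ContinuousAdd F]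
  [ContinuousSMul ℝ F] {W : Set F} {x y : W} {γ₁ γ₂ : Path x y}

theorem homotopic_of_segment_subset (h : ∀ t, segment ℝ (γ₁ t : F) (γ₂ t) ⊆ W) :
    γ₁.Homotopic γ₂ := by
  let H (z : I × I) : W := ⟨(1 - z.1 : ℝ) • (γ₁ z.2 : F) + (z.1 : ℝ) • (γ₂ z.2 : F),
    h z.2 ⟨_, _, sub_nonneg.2 z.1.2.2, z.1.2.1, sub_add_cancel _ _, rfl⟩⟩
  have hH : Continuous H := by fun_prop
  refine ⟨⟨⟨⟨H, hH⟩, fun t => Subtype.ext (by simp [H]), fun t => Subtype.ext (by simp [H])⟩, ?_⟩⟩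
  rintro s t (rfl | rfl) <;> exact Subtype.ext (by simp [H, ← add_smul])

theorem homotopic_of_cone_subset {q : F} (h₁ : ∀ t, segment ℝ (γ₁ t : F) q ⊆ W)
    (h₂ : ∀ t, segment ℝ (γ₂ t : F) q ⊆ W) : γ₁.Homotopic γ₂ := by
  let cone (γ : Path x y) (h : ∀ t, segment ℝ (γ t : F) q ⊆ W) (z : I × I) : W :=
    ⟨(1 - z.2 : ℝ) • (γ z.1 : F) + (z.2 : ℝ) • q,
      h z.1 ⟨_, _, sub_nonneg.2 z.2.2.2, z.2.2.1, sub_add_cancel _ _, rfl⟩⟩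
  have hcone (γ h) : Continuous (cone γ h) := by fun_prop
  have : ContractibleSpace I := (convex_Icc (0 : ℝ) 1).contractibleSpace ⟨0, zero_mem⟩
  obtain ⟨β₀, hβ₀⟩ := joinedIn_unitSquare_three_sides
  let bottom : Path ((0, 0) : I × I) (1, 0) := ⟨⟨fun t => (t, 0), by fun_prop⟩, rfl, rfl⟩
  refine homotopic_of_eq_along_path (hcone γ₁ h₁) (hcone γ₂ h₂) (β₀ := β₀) (fun t => ?_) bottom
    (fun t => Subtype.ext (by simp [cone, bottom])) (fun t => Subtype.ext (by simp [cone, bottom]))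
  rcases hβ₀ t with h | h | h <;> simp [cone, h]

end Homotopy

section Complement

open Topology unitInterval

variable {F : Type*} [NormedAddCommGroup F] [NormedSpace ℝ F]

theorem exists_contDiff_approx_of_endpoints {γ : ℝ → F} (hγ : Continuous γ) {ε : ℝ} (hε : 0 < ε) :
    ∃ g : ℝ → F, ContDiff ℝ 1 g ∧ g 0 = γ 0 ∧ g 1 = γ 1 ∧ ∀ t ∈ I, dist (g t) (γ t) < ε := by
  obtain ⟨g, hg, hgγ, -⟩ := hγ.exists_contDiff_approx 1 (ε := fun _ => ε / 2) continuous_const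
    fun _ => half_pos hε
  have hball (x : ℝ) : γ x - g x ∈ Metric.ball (0 : F) (ε / 2) := by
    simpa [dist_eq_norm, norm_sub_rev] using hgγ x
  refine ⟨fun t => g t + ((1 - t) • (γ 0 - g 0) + t • (γ 1 - g 1)), ?_, by simp, by simp,
    fun t ht => ?_⟩
  · have : ContDiff ℝ 1 g := hg
    fun_prop
  have herr := convex_ball (0 : F) (ε / 2) (hball 0) (hball 1) (sub_nonneg.2 ht.2) ht.1
    (sub_add_cancel 1 t)
  have herr' := hball t
  rw [mem_ball_zero_iff] at herr herr'
  calc dist (g t + ((1 - t) • (γ 0 - g 0) + t • (γ 1 - g 1))) (γ t)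
      = ‖(1 - t) • (γ 0 - g 0) + t • (γ 1 - g 1) - (γ t - g t)‖ := by
        rw [dist_eq_norm]; congr 1; abel
    _ < ε := (norm_sub_le _ _).trans_lt (by linarith)

theorem exists_contDiff_homotopic {W : Set F} (hW : IsOpen W) {x y : W} (γ : Path x y) :
    ∃ g : ℝ → F, ContDiff ℝ 1 g ∧ ∃ γ' : Path x y, (∀ t : I, γ' t = g t) ∧ γ.Homotopic γ' := by
  have hγ : Continuous fun t : ℝ => (γ.extend t : F) :=
    continuous_subtype_val.comp γ.continuous_extend
  obtain ⟨ε, hε, hsub⟩ := (isCompact_range (continuous_subtype_val.comp γ.continuous)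
    ).exists_thickening_subset_open hW (by rintro _ ⟨t, rfl⟩; exact (γ t).2)
  obtain ⟨g, hg, hg0, hg1, hgγ⟩ := exists_contDiff_approx_of_endpoints hγ hε
  have hball (t : I) : Metric.ball (γ t : F) ε ⊆ W :=
    (Metric.ball_subset_thickening (Set.mem_range_self t) ε).trans hsub
  have hgball (t : I) : g t ∈ Metric.ball (γ t : F) ε := by simpa using hgγ t t.2
  refine ⟨g, hg, ⟨⟨fun t => ⟨g t, hball t (hgball t)⟩, ?_⟩, ?_, ?_⟩, fun t => rfl, ?_⟩
  · have := hg.continuous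
    fun_prop
  · exact Subtype.ext (by simpa using hg0)
  · exact Subtype.ext (by simpa using hg1)
  · exact homotopic_of_segment_subset fun t => ((convex_ball _ _).segment_subset
      (Metric.mem_ball_self hε) (hgball t)).trans (hball t)

theorem dimH_cone_vertices_le [FiniteDimensional ℝ F] {g : ℝ → F} (hg : ContDiff ℝ 1 g)
    (L : Submodule ℝ F) :
    dimH {q : F | ∃ t s : ℝ, s ≠ 0 ∧ (1 - s) • g t + s • q ∈ L} ≤
      (Module.finrank ℝ L + 2 : ℕ) := by
  -- Such a vertex is `q = l - (u - 1) • g t` with `u = s⁻¹` and `l ∈ L`.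
  let f : ℝ × ℝ × L → F := fun z => (z.2.2 : F) - (z.1 - 1) • g z.2.1
  have hf : ContDiff ℝ 1 f := by
    have : ContDiff ℝ 1 fun z : ℝ × ℝ × L => (z.2.2 : F) :=
      L.subtypeL.contDiff.comp (contDiff_snd.comp contDiff_snd)
    fun_prop
  have hrange : {q : F | ∃ t s : ℝ, s ≠ 0 ∧ (1 - s) • g t + s • q ∈ L} ⊆ Set.range f := by
    rintro q ⟨t, s, hs, hq⟩
    refine ⟨(s⁻¹, t, ⟨s⁻¹ • ((1 - s) • g t + s • q), L.smul_mem _ hq⟩), ?_⟩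
    simp only [f]
    match_scalars <;> field_simp
    ring
  have hdim : Module.finrank ℝ (ℝ × ℝ × L) = Module.finrank ℝ L + 2 := by
    simp only [Module.finrank_prod, Module.finrank_self]
    ring
  exact (dimH_mono hrange).trans (hdim ▸ hf.dimH_range_le)

theorem eventually_cone_mem {Ω : Set F} (hΩ : IsOpen Ω) (hstar : StarConvex ℝ 0 Ω) {g : ℝ → F}
    (hg : Continuous g) (hgΩ : ∀ t ∈ I, g t ∈ Ω) :
    ∀ᶠ q in 𝓝 (0 : F), ∀ z ∈ I ×ˢ I, (1 - z.2) • g z.1 + z.2 • q ∈ Ω := by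
  refine (isCompact_Icc.prod isCompact_Icc).eventually_forall_of_forall_eventually ?_
  rintro ⟨t, s⟩ ⟨ht, hs⟩
  have hmem : (1 - s) • g t + s • (0 : F) ∈ Ω := by
    simpa [add_comm] using hstar (hgΩ t ht) hs.1 (sub_nonneg.2 hs.2) (add_sub_cancel s 1)
  have hcont : Continuous fun p : F × ℝ × ℝ => (1 - p.2.2) • g p.2.1 + p.2.2 • p.1 := by fun_prop
  exact hcont.continuousAt.eventually_mem (hΩ.mem_nhds hmem)

variable [FiniteDimensional ℝ F] {ι : Type*} [Countable ι] {L : ι → Submodule ℝ F} {Ω : Set F}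

theorem dense_compl_cone_vertices (hL : ∀ i, Module.finrank ℝ (L i) + 3 ≤ Module.finrank ℝ F)
    {κ : Type*} [Countable κ] {g : κ → ℝ → F} (hg : ∀ k, ContDiff ℝ 1 (g k)) :
    Dense {q : F | ∀ k i, ∀ t s : ℝ, s ≠ 0 → (1 - s) • g k t + s • q ∉ L i} := by
  let bad (p : κ × ι) : Set F := {q | ∃ t s : ℝ, s ≠ 0 ∧ (1 - s) • g p.1 t + s • q ∈ L p.2}
  suffices Dense (⋃ p, bad p)ᶜ by
    refine this.mono ?_
    intro q hq k i t s hs hmem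
    exact hq (Set.mem_iUnion.2 ⟨(k, i), t, s, hs, hmem⟩)
  rcases isEmpty_or_nonempty ι with hι | ⟨⟨i₀⟩⟩
  · simp
  refine dense_compl_of_dimH_lt_finrank ?_
  calc dimH (⋃ p, bad p) ≤ (Module.finrank ℝ F - 1 : ℕ) := by
        rw [dimH_iUnion]
        refine iSup_le fun p => (dimH_cone_vertices_le (hg p.1) (L p.2)).trans ?_
        have := hL p.2
        exact_mod_cast (by omega)
    _ < Module.finrank ℝ F := by
        have := hL i₀
        exact_mod_cast (by omega)

theorem exists_common_cone_vertex (hL : ∀ i, Module.finrank ℝ (L i) + 3 ≤ Module.finrank ℝ F)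
    (hΩ : IsOpen Ω) (hstar : StarConvex ℝ 0 Ω) {κ : Type*} [Finite κ] {g : κ → ℝ → F}
    (hg : ∀ k, ContDiff ℝ 1 (g k)) (hgΩ : ∀ k, ∀ t ∈ I, g k t ∈ Ω) :
    ∃ q : F, ∀ k, ∀ t ∈ I, ∀ s ∈ I, s ≠ 0 →
      (1 - s) • g k t + s • q ∈ Ω \ ⋃ i, (L i : Set F) := by
  have hnear := Filter.eventually_all.2 fun k =>
    eventually_cone_mem hΩ hstar (hg k).continuous (hgΩ k)
  obtain ⟨q, hqL, hqΩ⟩ := (dense_compl_cone_vertices hL hg).inter_nhds_nonempty hnear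
  refine ⟨q, fun k t ht s hs hs0 => ⟨hqΩ k (t, s) ⟨ht, hs⟩, ?_⟩⟩
  simpa using fun i => hqL k i t s hs0

theorem exists_cone_subset (hL : ∀ i, Module.finrank ℝ (L i) + 3 ≤ Module.finrank ℝ F)
    (hΩ : IsOpen Ω) (hstar : StarConvex ℝ 0 Ω) {κ : Type*} [Finite κ] {g : κ → ℝ → F}
    (hg : ∀ k, ContDiff ℝ 1 (g k)) (hgW : ∀ k, ∀ t ∈ I, g k t ∈ Ω \ ⋃ i, (L i : Set F)) :
    ∃ q : F, ∀ k, ∀ t ∈ I, segment ℝ (g k t) q ⊆ Ω \ ⋃ i, (L i : Set F) := by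
  obtain ⟨q, hq⟩ := exists_common_cone_vertex hL hΩ hstar hg fun k t ht => (hgW k t ht).1
  refine ⟨q, fun k t ht => ?_⟩
  rw [segment_eq_image]
  rintro _ ⟨s, hs, rfl⟩
  rcases eq_or_ne s 0 with rfl | hs0
  · simpa using hgW k t ht
  · exact hq k t ht s hs hs0

theorem isPathConnected_starConvex_diff
    (hL : ∀ i, Module.finrank ℝ (L i) + 3 ≤ Module.finrank ℝ F) (hΩ : IsOpen Ω)
    (hstar : StarConvex ℝ 0 Ω) (h0 : (0 : F) ∈ Ω) :
    IsPathConnected (Ω \ ⋃ i, (L i : Set F)) := by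
  obtain ⟨q₀, hq₀⟩ := exists_common_cone_vertex hL hΩ hstar (κ := Unit) (g := fun _ _ => 0)
    (fun _ => contDiff_const) fun _ _ _ => h0
  refine isPathConnected_iff.2
    ⟨⟨q₀, by simpa using hq₀ () 0 zero_mem 1 one_mem one_ne_zero⟩, fun x hx y hy => ?_⟩
  obtain ⟨q, hq⟩ := exists_cone_subset hL hΩ hstar (κ := Fin 2) (g := fun k _ => ![x, y] k)
    (fun _ => contDiff_const) (Fin.forall_fin_two.2 ⟨fun _ _ => hx, fun _ _ => hy⟩)
  exact (JoinedIn.of_segment_subset (hq 0 0 zero_mem)).trans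
    (JoinedIn.of_segment_subset (hq 1 0 zero_mem)).symm

theorem simplyConnectedSpace_starConvex_diff
    (hL : ∀ i, Module.finrank ℝ (L i) + 3 ≤ Module.finrank ℝ F) (hΩ : IsOpen Ω)
    (hstar : StarConvex ℝ 0 Ω) (h0 : (0 : F) ∈ Ω) (hW : IsOpen (Ω \ ⋃ i, (L i : Set F))) :
    SimplyConnectedSpace ↥(Ω \ ⋃ i, (L i : Set F)) := by
  refine simply_connected_iff_paths_homotopic'.2 ⟨isPathConnected_iff_pathConnectedSpace.1
    (isPathConnected_starConvex_diff hL hΩ hstar h0), fun {x y} γ₁ γ₂ => ?_⟩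
  obtain ⟨g₁, hg₁, γ₁', hγ₁', hom₁⟩ := exists_contDiff_homotopic hW γ₁
  obtain ⟨g₂, hg₂, γ₂', hγ₂', hom₂⟩ := exists_contDiff_homotopic hW γ₂
  have hg₁W (t) (ht : t ∈ I) : g₁ t ∈ Ω \ ⋃ i, (L i : Set F) := hγ₁' ⟨t, ht⟩ ▸ (γ₁' ⟨t, ht⟩).2
  have hg₂W (t) (ht : t ∈ I) : g₂ t ∈ Ω \ ⋃ i, (L i : Set F) := hγ₂' ⟨t, ht⟩ ▸ (γ₂' ⟨t, ht⟩).2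
  obtain ⟨q, hq⟩ := exists_cone_subset hL hΩ hstar (g := ![g₁, g₂])
    (Fin.forall_fin_two.2 ⟨hg₁, hg₂⟩) (Fin.forall_fin_two.2 ⟨hg₁W, hg₂W⟩)
  have hom : γ₁'.Homotopic γ₂' := homotopic_of_cone_subset (q := q)
    (fun t => hγ₁' t ▸ hq 0 t t.2) (fun t => hγ₂' t ▸ hq 1 t t.2)
  exact hom₁.trans (hom.trans hom₂.symm)

end Complement

/-! ### Invariants of a diagonal torus action -/

section TorusInvariants

open MvPolynomial

theorem map_ne_top_of_retraction {R S : Type*} [CommRing R] [CommRing S] [Algebra R S]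
    {r : S →ₗ[R] R} (hr : r 1 = 1) {I : Ideal R} (hI : I ≠ ⊤) : I.map (algebraMap R S) ≠ ⊤ := by
  intro htop
  have hmem : (1 : S) ∈ (I • ⊤ : Submodule R S) := by
    rw [Ideal.smul_top_eq_map, htop]
    exact Submodule.mem_top
  have hle : (I • ⊤ : Submodule R S).map r ≤ I := by
    rw [Submodule.map_smul'']
    exact Submodule.smul_le.2 fun i hi z _ => I.mul_mem_right z hi
  exact hI (I.eq_top_iff_one.2 (hr ▸ hle (Submodule.mem_map_of_mem hmem)))

theorem ringKrullDim_le_of_isIntegral {R S : Type*} [CommRing R] [CommRing S] [Algebra R S]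
    [Algebra.IsIntegral R S] : ringKrullDim S ≤ ringKrullDim R :=
  Order.krullDim_le_of_strictMono (PrimeSpectrum.comap (algebraMap R S))
    fun _ _ h => Ideal.IsIntegral.comap_lt_comap h

theorem exists_ringKrullDim_le_and_le_trdeg (k A : Type*) [Field k] [CommRing A] [Nontrivial A]
    [Algebra k A] [Algebra.FiniteType k A] :
    ∃ n : ℕ, ringKrullDim A ≤ n ∧ (n : Cardinal) ≤ Algebra.trdeg k A := by
  obtain ⟨n, g, hg, hint⟩ := exists_integral_inj_algHom_of_fg k A
  refine ⟨n, ?_, ?_⟩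
  · let _ : Algebra (MvPolynomial (Fin n) k) A := g.toRingHom.toAlgebra
    have : Algebra.IsIntegral (MvPolynomial (Fin n) k) A := ⟨hint⟩
    refine (ringKrullDim_le_of_isIntegral (R := MvPolynomial (Fin n) k)).trans ?_
    rw [MvPolynomial.ringKrullDim_of_isNoetherianRing]
    simp
  · have halg : AlgebraicIndependent k fun i : Fin n => g (X i) := by
      rw [AlgebraicIndependent]
      convert hg
      ext
      simp
    simpa using halg.lift_cardinalMk_le_trdeg

variable {σ : Type*} (a : σ → ℤ)

/-- The invariants of the action of `ℂ^*` on `ℂ^σ` by `t • v = (t ^ a i * v i)`: the polynomials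
all of whose monomials have weight zero, where `X i` has weight `a i`. -/
def torusInvariants : Subalgebra ℂ (MvPolynomial σ ℂ) where
  carrier := {h | IsWeightedHomogeneous a h 0}
  mul_mem' hx hy := by simpa using! IsWeightedHomogeneous.mul hx hy
  add_mem' hx hy := IsWeightedHomogeneous.add hx hy
  algebraMap_mem' r := isWeightedHomogeneous_C a r

variable {a}

theorem mem_torusInvariants {h : MvPolynomial σ ℂ} :
    h ∈ torusInvariants a ↔ IsWeightedHomogeneous a h 0 := Iff.rfl

variable (a) in
/-- The monoid of exponents of invariant monomials. -/
def invariantExponents : AddSubmonoid (σ →₀ ℕ) := AddMonoidHom.mker (Finsupp.weight a)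

theorem mem_invariantExponents {d : σ →₀ ℕ} :
    d ∈ invariantExponents a ↔ Finsupp.weight a d = 0 := Iff.rfl

theorem invariantExponents_fg [Finite σ] : (invariantExponents a).FG := by
  refine AddSubmonoid.fg_of_subtractive fun d hd e he => ?_
  rw [mem_invariantExponents] at hd he ⊢
  rwa [map_add, hd, zero_add] at he

/-- The invariant monomial with a given exponent, as an element of `torusInvariants a`. -/
def invariantMonomial (d : invariantExponents a) : torusInvariants a :=
  ⟨monomial (d : σ →₀ ℕ) 1, isWeightedHomogeneous_monomial a _ _ (mem_invariantExponents.1 d.2)⟩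

@[simp]
theorem coe_invariantMonomial (d : invariantExponents a) :
    (invariantMonomial d : MvPolynomial σ ℂ) = monomial (d : σ →₀ ℕ) 1 := rfl

theorem invariantMonomial_add (d e : invariantExponents a) :
    invariantMonomial (d + e) = invariantMonomial d * invariantMonomial e :=
  Subtype.ext (by simp)

theorem invariantMonomial_zero : invariantMonomial (0 : invariantExponents a) = 1 :=
  Subtype.ext (by simp)

theorem span_range_invariantMonomial :
    Submodule.span ℂ (Set.range (invariantMonomial (a := a))) = ⊤ := by
  rw [eq_top_iff]
  rintro ⟨h, hh⟩ -
  refine IsWeightedHomogeneous.induction_on (w := a) (m := 0)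
    (motive := fun p hp => (⟨p, hp⟩ : torusInvariants a) ∈
      Submodule.span ℂ (Set.range (invariantMonomial (a := a)))) (Submodule.zero_mem _)
    (fun p q hp hq h1 h2 => Submodule.add_mem _ h1 h2) (fun d r hd => ?_) hh
  have hsmul : (⟨monomial d r, isWeightedHomogeneous_monomial a d r hd⟩ : torusInvariants a) =
      r • invariantMonomial ⟨d, hd⟩ := Subtype.ext (by simp [smul_monomial])
  rw [hsmul]
  exact Submodule.smul_mem _ _ (Submodule.subset_span ⟨_, rfl⟩)

theorem torusInvariants_linearMap_ext {M : Type*} [AddCommMonoid M] [Module ℂ M]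
    {f g : torusInvariants a →ₗ[ℂ] M}
    (h : ∀ d, f (invariantMonomial d) = g (invariantMonomial d)) : f = g :=
  LinearMap.ext_on_range span_range_invariantMonomial h

theorem adjoin_invariantMonomial_of_closure_eq_top {S : Set (invariantExponents a)}
    (hS : AddSubmonoid.closure S = ⊤) : Algebra.adjoin ℂ (invariantMonomial '' S) = ⊤ := by
  have hmem (d : invariantExponents a) :
      invariantMonomial d ∈ Algebra.adjoin ℂ (invariantMonomial '' S) := by
    have hd : d ∈ AddSubmonoid.closure S := hS ▸ AddSubmonoid.mem_top d
    induction hd using AddSubmonoid.closure_induction with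
    | mem d hd => exact Algebra.subset_adjoin ⟨d, hd, rfl⟩
    | zero => exact invariantMonomial_zero (a := a) ▸ Subalgebra.one_mem _
    | add d e _ _ hd he => exact invariantMonomial_add d e ▸ Subalgebra.mul_mem _ hd he
  rw [← Algebra.toSubmodule_eq_top, eq_top_iff, ← span_range_invariantMonomial]
  exact Submodule.span_le.2 (Set.range_subset_iff.2 hmem)

instance [Finite σ] : Algebra.FiniteType ℂ (torusInvariants a) := by
  obtain ⟨S, hS⟩ := ((AddMonoid.fg_iff_addSubmonoid_fg _).2 (invariantExponents_fg (a := a))).fg_top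
  classical
  refine ⟨⟨S.image invariantMonomial, ?_⟩⟩
  rw [Finset.coe_image]
  exact adjoin_invariantMonomial_of_closure_eq_top hS

instance [Finite σ] : IsNoetherianRing (torusInvariants a) :=
  Algebra.FiniteType.isNoetherianRing ℂ _

theorem weightedHomogeneousComponent_zero_mul {h : MvPolynomial σ ℂ} (hh : h ∈ torusInvariants a)
    (f : MvPolynomial σ ℂ) :
    weightedHomogeneousComponent a 0 (h * f) = h * weightedHomogeneousComponent a 0 f := by
  induction f using MvPolynomial.induction_on' with
  | monomial d r =>
    have hd := isWeightedHomogeneous_monomial (R := ℂ) a d r rfl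
    have hm : IsWeightedHomogeneous a (h * monomial d r) (Finsupp.weight a d) := by
      simpa using IsWeightedHomogeneous.mul (mem_torusInvariants.1 hh) hd
    by_cases h0 : Finsupp.weight a d = 0
    · rw [h0] at hd hm
      rw [hd.weightedHomogeneousComponent_same, hm.weightedHomogeneousComponent_same]
    · rw [hd.weightedHomogeneousComponent_ne 0 (Ne.symm h0),
        hm.weightedHomogeneousComponent_ne 0 (Ne.symm h0), mul_zero]
  | add p q hp hq => simp only [mul_add, map_add, hp, hq]

variable (a) in
/-- The Reynolds operator of the torus action: the projection of a polynomial to its part of weight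
zero, which is linear over the invariants. -/
def reynolds : MvPolynomial σ ℂ →ₗ[torusInvariants a] torusInvariants a where
  toFun f := ⟨weightedHomogeneousComponent a 0 f,
    weightedHomogeneousComponent_isWeightedHomogeneous 0 f⟩
  map_add' f g := Subtype.ext (map_add _ f g)
  map_smul' h f := Subtype.ext (weightedHomogeneousComponent_zero_mul h.2 f)

theorem reynolds_one : reynolds a 1 = 1 :=
  Subtype.ext (isWeightedHomogeneous_one ℂ a).weightedHomogeneousComponent_same

/-- The value of a regular function at a complex point. -/
def ComplexPoints.eval {A : Type*} [CommRing A] [Algebra ℂ A] (h : A) (x : ComplexPoints A) : ℂ :=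
  (show A →ₐ[ℂ] ℂ from x) h

variable (a) in
/-- The quotient map `ℂ^σ → ℂ^σ // ℂ^*` in coordinates. -/
def evalPoint (v : σ → ℂ) : ComplexPoints (torusInvariants a) :=
  (aeval v).comp (torusInvariants a).val

theorem eval_evalPoint (h : torusInvariants a) (v : σ → ℂ) :
    (evalPoint a v).eval h = aeval v (h : MvPolynomial σ ℂ) := rfl

theorem evalPoint_surjective [Finite σ] : Function.Surjective (evalPoint a) := by
  intro x
  let x' : torusInvariants a →ₐ[ℂ] ℂ := x
  obtain ⟨M, hM, hle⟩ := Ideal.exists_le_maximal _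
    (map_ne_top_of_retraction (r := reynolds a) reynolds_one (RingHom.ker_ne_top x'))
  obtain ⟨v, rfl⟩ := eq_vanishingIdeal_singleton_of_isMaximal ℂ hM
  refine ⟨v, AlgHom.ext fun h => ?_⟩
  have hker : h - algebraMap ℂ _ (x' h) ∈ RingHom.ker x' := by simp [RingHom.mem_ker]
  have hvanish := hle (Ideal.mem_map_of_mem _ hker)
  rw [mem_vanishingIdeal_singleton_iff, map_sub, map_sub, sub_eq_zero] at hvanish
  exact hvanish.trans (AlgHom.commutes (aeval v) _)

theorem transcendental_X {α : σ} (hα : a α ≠ 0) :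
    Transcendental (torusInvariants a) (X α : MvPolynomial σ ℂ) := by
  rw [transcendental_iff]
  intro p hp
  ext n : 1
  have hterm (i : ℕ) : IsWeightedHomogeneous a
      (p.coeff i • (X α : MvPolynomial σ ℂ) ^ i) (i • a α) := by
    rw [Algebra.smul_def]
    simpa using IsWeightedHomogeneous.mul (mem_torusInvariants.1 (p.coeff i).2)
      ((isWeightedHomogeneous_X ℂ a α).pow i)
  have hne (i : ℕ) (hi : i ≠ n) : weightedHomogeneousComponent a (n • a α)
      (p.coeff i • (X α : MvPolynomial σ ℂ) ^ i) = 0 := by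
    refine (hterm i).weightedHomogeneousComponent_ne _ fun h => hi ?_
    simp only [nsmul_eq_mul] at h
    exact_mod_cast (mul_right_cancel₀ hα h).symm
  by_cases hn : n ∈ Finset.range (p.natDegree + 1)
  · have hcomp := congrArg (weightedHomogeneousComponent a (n • a α)) hp
    rw [Polynomial.aeval_eq_sum_range, map_sum, map_zero,
      Finset.sum_eq_single_of_mem n hn (fun i _ hi => hne i hi),
      (hterm n).weightedHomogeneousComponent_same, Algebra.smul_def] at hcomp
    exact Subtype.ext ((mul_eq_zero.1 hcomp).resolve_right (pow_ne_zero _ (X_ne_zero α)))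
  · rw [Finset.mem_range, not_lt] at hn
    rw [Polynomial.coeff_eq_zero_of_natDegree_lt (by omega), Polynomial.coeff_zero]

theorem ringKrullDim_torusInvariants_le [Finite σ] {α : σ} (hα : a α ≠ 0) :
    ringKrullDim (torusInvariants a) ≤ (Nat.card σ - 1 : ℕ) := by
  obtain ⟨n, hdim, hn⟩ := exists_ringKrullDim_le_and_le_trdeg ℂ (torusInvariants a)
  have : Algebra.Transcendental (torusInvariants a) (MvPolynomial σ ℂ) :=
    ⟨X α, transcendental_X hα⟩
  have hfibre : (1 : Cardinal) ≤ Algebra.trdeg (torusInvariants a) (MvPolynomial σ ℂ) :=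
    Cardinal.one_le_iff_pos.2 (trdeg_pos _ _)
  have hadd := trdeg_add_le (R := ℂ) (S := torusInvariants a) (A := MvPolynomial σ ℂ)
  rw [MvPolynomial.trdeg_of_isDomain] at hadd
  have hcard : ((n + 1 : ℕ) : Cardinal) ≤ (Nat.card σ : Cardinal) := by
    push_cast
    refine (add_le_add hn hfibre).trans (hadd.trans ?_)
    simp [Nat.cast_card]
  have : n + 1 ≤ Nat.card σ := by exact_mod_cast hcard
  exact hdim.trans (by exact_mod_cast (by omega : n ≤ Nat.card σ - 1))

end TorusInvariants

/-! ### Point derivations and regularity -/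

section PointDerivations

theorem exists_finset_map_span_eq {R S : Type*} [CommRing R] [CommRing S] [Algebra R S]
    (M : Submonoid R) [IsLocalization M S] {I : Ideal S} (hI : I.FG) :
    ∃ s : Finset R, s.card ≤ I.spanFinrank ∧ (Ideal.span s).map (algebraMap R S) = I := by
  classical
  obtain ⟨T, hcard, rfl⟩ := Submodule.FG.exists_span_finset_card_eq_spanFinrank hI
  choose q hq using IsLocalization.surj (S := S) M
  refine ⟨T.image fun z => (q z).1, hcard ▸ Finset.card_image_le, ?_⟩
  rw [Ideal.map_span, Finset.coe_image]
  refine le_antisymm (Ideal.span_le.2 ?_) (Submodule.span_le.2 fun z hz => ?_)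
  · rintro _ ⟨_, ⟨z, hz, rfl⟩, rfl⟩
    exact hq z ▸ Ideal.mul_mem_right _ _ (Submodule.subset_span hz)
  · rw [SetLike.mem_coe, ← Ideal.mul_unit_mem_iff_mem _ (IsLocalization.map_units S (q z).2), hq z]
    exact Ideal.subset_span ⟨_, ⟨z, hz, rfl⟩, rfl⟩

attribute [local instance] RingHom.ker_isPrime

variable {k A : Type*} [Field k] [CommRing A] [Algebra k A]

/-- The space of point derivations of `A` at the `k`-point `x`, i.e. the tangent space of `Spec A`
at `x`. -/
def pointDerivations (x : A →ₐ[k] k) : Submodule k (A →ₗ[k] k) where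
  carrier := {D | ∀ f g, D (f * g) = x f * D g + D f * x g}
  zero_mem' := by simp
  add_mem' hD hE f g := by simp only [LinearMap.add_apply, hD f g, hE f g]; ring
  smul_mem' c D hD f g := by simp only [LinearMap.smul_apply, smul_eq_mul, hD f g]; ring

theorem pointDerivations_ext_of_ker {x : A →ₐ[k] k} {D E : A →ₗ[k] k}
    (hD : D ∈ pointDerivations x) (hE : E ∈ pointDerivations x)
    (h : ∀ f, x f = 0 → D f = E f) : D = E := by
  ext f
  have hD1 : D 1 = 0 := by simpa using hD 1 1
  have hE1 : E 1 = 0 := by simpa using hE 1 1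
  simpa [Algebra.algebraMap_eq_smul_one, hD1, hE1] using h (f - algebraMap k A (x f)) (by simp)

theorem pointDerivations_ext {x : A →ₐ[k] k} {D E : A →ₗ[k] k}
    (hD : D ∈ pointDerivations x) (hE : E ∈ pointDerivations x) {s : Set A}
    (hs : (Ideal.span s).map (algebraMap A (Localization.AtPrime (RingHom.ker x))) =
      IsLocalRing.maximalIdeal _) (hDE : Set.EqOn D E s) : D = E := by
  have hxs {f : A} (hf : f ∈ Ideal.span s) : x f = 0 := by
    rw [← RingHom.mem_ker, ← IsLocalization.AtPrime.to_map_mem_maximal_iff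
      (Localization.AtPrime (RingHom.ker x)) (RingHom.ker x), ← hs]
    exact Ideal.mem_map_of_mem _ hf
  have hspan {f : A} (hf : f ∈ Ideal.span s) : D f = E f := by
    induction hf using Submodule.span_induction with
    | mem f hf => exact hDE hf
    | zero => rw [map_zero, map_zero]
    | add f g _ _ hf hg => rw [map_add, map_add, hf, hg]
    | smul r f hf' hf => rw [smul_eq_mul, hD, hE, hf, hxs hf', mul_zero, mul_zero]
  refine pointDerivations_ext_of_ker hD hE fun f hf => ?_
  have hmem : algebraMap A (Localization.AtPrime (RingHom.ker x)) f ∈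
      (Ideal.span s).map (algebraMap A _) := by
    rw [hs, ← IsLocalization.AtPrime.map_eq_maximalIdeal (RingHom.ker x)]
    exact Ideal.mem_map_of_mem _ hf
  obtain ⟨u, hu, hmul⟩ : ∃ u ∉ RingHom.ker x, u * f ∈ Ideal.span s := by
    rwa [IsLocalization.algebraMap_mem_map_algebraMap_iff (RingHom.ker x).primeCompl] at hmem
  have huf := hspan hmul
  rw [hD, hE, hf, mul_zero, mul_zero, add_zero, add_zero] at huf
  exact mul_left_cancel₀ hu huf

theorem rank_pointDerivations_le (x : A →ₐ[k] k)
    [IsNoetherianRing (Localization.AtPrime (RingHom.ker x))] :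
    Module.rank k (pointDerivations x) ≤
      (IsLocalRing.maximalIdeal (Localization.AtPrime (RingHom.ker x))).spanFinrank := by
  obtain ⟨s, hcard, hs⟩ := exists_finset_map_span_eq (RingHom.ker x).primeCompl
    (IsNoetherian.noetherian (IsLocalRing.maximalIdeal (Localization.AtPrime (RingHom.ker x))))
  let restrict : pointDerivations x →ₗ[k] s → k :=
    (LinearMap.pi fun f => LinearMap.applyₗ (f : A)) ∘ₗ (pointDerivations x).subtype
  have hinj : Function.Injective restrict := fun D E hDE => Subtype.ext <|
    pointDerivations_ext D.2 E.2 hs fun f hf => congrFun hDE ⟨f, hf⟩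
  refine (LinearMap.rank_le_of_injective restrict hinj).trans ?_
  simpa using hcard

theorem natCard_le_height_ker (x : A →ₐ[k] k)
    [h : IsRegularLocalRing (Localization.AtPrime (RingHom.ker x))] {ι : Type*} [Finite ι]
    {D : ι → A →ₗ[k] k} (hD : ∀ i, D i ∈ pointDerivations x) (hli : LinearIndependent k D) :
    (Nat.card ι : ℕ∞) ≤ (RingHom.ker x).height := by
  have hli' : LinearIndependent k fun i => (⟨D i, hD i⟩ : pointDerivations x) :=
    LinearIndependent.of_comp (pointDerivations x).subtype hli
  have hle := hli'.cardinal_lift_le_rank.trans (Cardinal.lift_le.2 (rank_pointDerivations_le x))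
  rw [← Nat.cast_card, Cardinal.lift_natCast, Cardinal.lift_natCast, Nat.cast_le] at hle
  have hdim := h.spanFinrank_maximalIdeal
  rw [IsLocalization.AtPrime.ringKrullDim_eq_height (RingHom.ker x)] at hdim
  have hcast : ((Nat.card ι : ℕ∞) : WithBot ℕ∞) ≤ (RingHom.ker x).height :=
    hdim ▸ by exact_mod_cast hle
  exact_mod_cast hcast

theorem natCard_le_of_notMem_singularLocus {A : Type*} [CommRing A] [Algebra ℂ A]
    {x : A →ₐ[ℂ] ℂ} (hreg : (show ComplexPoints A from x) ∉ singularLocus A) {d : ℕ}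
    (hd : ringKrullDim A ≤ d) {ι : Type*} [Finite ι] {D : ι → A →ₗ[ℂ] ℂ}
    (hD : ∀ i, D i ∈ pointDerivations x) (hli : LinearIndependent ℂ D) : Nat.card ι ≤ d := by
  have : IsRegularLocalRing (Localization.AtPrime (RingHom.ker x)) := not_not.1 hreg
  have hle : ((Nat.card ι : ℕ∞) : WithBot ℕ∞) ≤ d :=
    (WithBot.coe_le_coe.2 (natCard_le_height_ker x hD hli)).trans
      (Ideal.height_le_ringKrullDim_of_isPrime.trans hd)
  exact_mod_cast hle

end PointDerivations

/-! ### Exponents modulo the stabilizer of a point -/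

section Exponents

open Finsupp

variable {σ : Type*} {a : σ → ℤ}

variable (a) in
/-- The stabilizer in `ℂ^*` of the points with support `I` has order `k`, or `k = 0` if these points
are fixed. Dually, the monomials in the coordinates from `I` have the multiples of `k` as their
weights; this forces `I` to contain weights of both signs unless all its weights vanish. -/
def IsStabilizerOrder (I : Set σ) (k : ℕ) : Prop :=
  ∀ m : ℤ, (∃ u ∈ supported ℕ ℕ I, weight a u = m) ↔ (k : ℤ) ∣ m

theorem IsStabilizerOrder.dvd {I : Set σ} {k : ℕ} (h : IsStabilizerOrder a I k) {i : σ}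
    (hi : i ∈ I) : (k : ℤ) ∣ a i :=
  (h _).1 ⟨single i 1, single_mem_supported ℕ 1 hi, by simp [weight_single]⟩

theorem isStabilizerOrder_zero {I : Set σ} (hI : ∀ i ∈ I, a i = 0) : IsStabilizerOrder a I 0 := by
  have hw {u : σ →₀ ℕ} (hu : u ∈ supported ℕ ℕ I) : weight a u = 0 :=
    Finset.sum_eq_zero fun i hi => by simp [hI i (hu hi)]
  intro m
  rw [Nat.cast_zero, zero_dvd_iff]
  exact ⟨fun ⟨u, hu, hm⟩ => hm ▸ hw hu, fun hm => ⟨0, zero_mem _, by simp [hm]⟩⟩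

theorem neg_mem_of_mem_of_pos_of_neg {M : AddSubmonoid ℤ} {p n : ℤ} (hp : p ∈ M) (hp0 : 0 < p)
    (hn : n ∈ M) (hn0 : n < 0) {m : ℤ} (hm : m ∈ M) : -m ∈ M := by
  have hmul {c d : ℤ} (hc : 0 ≤ c) (hd : d ∈ M) : c * d ∈ M := by
    lift c to ℕ using hc
    exact nsmul_eq_mul c d ▸ M.nsmul_mem hd c
  rcases le_total 0 m with h | h
  · convert M.add_mem (hmul (c := -n - 1) (by omega) hm) (hmul h hn) using 1
    ring
  · convert M.add_mem (hmul (c := p - 1) (by omega) hm) (hmul (c := -m) (by omega) hp) using 1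
    ring

theorem exists_isStabilizerOrder {I : Set σ} (hpos : ∃ i ∈ I, 0 < a i)
    (hneg : ∃ i ∈ I, a i < 0) : ∃ k, IsStabilizerOrder a I k := by
  let M : AddSubmonoid ℤ := (supported ℕ ℕ I).toAddSubmonoid.map (weight a : (σ →₀ ℕ) →+ ℤ)
  have hM {i : σ} (hi : i ∈ I) : a i ∈ M :=
    ⟨single i 1, single_mem_supported ℕ 1 hi, by simp [weight_single]⟩
  obtain ⟨i, hi, hi0⟩ := hpos
  obtain ⟨j, hj, hj0⟩ := hneg
  let H : AddSubgroup ℤ :=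
    { M with neg_mem' := neg_mem_of_mem_of_pos_of_neg (hM hi) hi0 (hM hj) hj0 }
  obtain ⟨g, hg⟩ := Int.subgroup_cyclic H
  refine ⟨g.natAbs, fun m => ?_⟩
  rw [Int.natAbs_dvd, ← Int.mem_zmultiples_iff, AddSubgroup.zmultiples_eq_closure, ← hg]
  rfl

theorem IsStabilizerOrder.exists_pos {I : Set σ} {k : ℕ} (h : IsStabilizerOrder a I k)
    (hk : k ≠ 0) : ∃ i ∈ I, 0 < a i := by
  obtain ⟨u, hu, hw⟩ := (h k).2 dvd_rfl
  by_contra! hI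
  have : weight a u ≤ 0 :=
    Finset.sum_nonpos fun i hi => nsmul_nonpos (hI i (hu hi)) _
  omega

theorem IsStabilizerOrder.exists_neg {I : Set σ} {k : ℕ} (h : IsStabilizerOrder a I k)
    (hk : k ≠ 0) : ∃ i ∈ I, a i < 0 := by
  obtain ⟨u, hu, hw⟩ := (h (-k)).2 (dvd_neg.2 dvd_rfl)
  by_contra! hI
  have : 0 ≤ weight a u :=
    Finset.sum_nonneg fun i hi => nsmul_nonneg (hI i (hu hi)) _
  omega

theorem IsStabilizerOrder.exists_add_mem {I : Set σ} {k : ℕ} (h : IsStabilizerOrder a I k)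
    {e : σ →₀ ℕ} (he : (k : ℤ) ∣ weight a e) :
    ∃ u ∈ supported ℕ ℕ I, e + u ∈ invariantExponents a := by
  obtain ⟨u, hu, hw⟩ := (h _).2 (dvd_neg.2 he)
  exact ⟨u, hu, by rw [mem_invariantExponents, map_add, hw, add_neg_cancel]⟩

variable (a) in
/-- An indecomposable element of the monoid of exponents whose weight is divisible by `k`. -/
def IsIrreducibleMod (k : ℕ) (e : σ →₀ ℕ) : Prop :=
  e ≠ 0 ∧ (k : ℤ) ∣ weight a e ∧ ∀ e' e'' : σ →₀ ℕ, (k : ℤ) ∣ weight a e' →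
    (k : ℤ) ∣ weight a e'' → e' + e'' = e → e' = 0 ∨ e'' = 0

theorem isIrreducibleMod_of_degree_le_three {k : ℕ} {e : σ →₀ ℕ} (he : e ≠ 0)
    (hk : (k : ℤ) ∣ weight a e) (hdeg : degree e ≤ 3) (hsupp : ∀ i, e i ≠ 0 → ¬ (k : ℤ) ∣ a i) :
    IsIrreducibleMod a k e := by
  have hone {d : σ →₀ ℕ} (hd : d ≤ e) (hkd : (k : ℤ) ∣ weight a d) : degree d ≠ 1 := by
    intro hd1
    obtain ⟨i, rfl⟩ : d ∈ Set.range fun i => single i 1 := by rwa [range_single_one]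
    refine hsupp i ?_ (by simpa [weight_single] using hkd)
    simpa [Nat.one_le_iff_ne_zero] using hd i
  refine ⟨he, hk, fun e' e'' h' h'' hadd => ?_⟩
  have h1 := hone (hadd ▸ le_self_add) h'
  have h2 := hone (hadd ▸ le_add_self) h''
  rw [← hadd, map_add] at hdeg
  rw [← degree_eq_zero_iff, ← degree_eq_zero_iff]
  omega

theorem isIrreducibleMod_single_add_single {k : ℕ} (hk : k ≠ 1) {α β : σ} (hα : a α = 1)
    (hβ : a β = -1) : IsIrreducibleMod a k (single α 1 + single β 1) := by
  have hk' : ¬ (k : ℤ) ∣ 1 := by rwa [Int.natCast_dvd, Int.natAbs_one, Nat.dvd_one]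
  refine isIrreducibleMod_of_degree_le_three (by simp) (by simp [weight_single, hα, hβ])
    (by simp) fun i hi => ?_
  obtain rfl | rfl : α = i ∨ β = i := by
    by_contra! h
    simp [h.1, h.2] at hi
  · rwa [hα]
  · rwa [hβ, dvd_neg]

theorem isIrreducibleMod_single {k : ℕ} (hk : k ≠ 0) {α : σ} (hα : a α = 1) :
    IsIrreducibleMod a k (single α k) := by
  have hwt (n : ℕ) : weight a (single α n) = n := by simp [weight_single, hα]
  have hle {d : σ →₀ ℕ} (hd : d ≤ single α k) : ∃ n, d = single α n :=
    support_subset_singleton'.1 ((support_mono hd).trans support_single_subset)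
  refine ⟨by simpa using hk, by rw [hwt], fun e' e'' h' _ hadd => ?_⟩
  obtain ⟨n, rfl⟩ := hle (hadd ▸ le_self_add : e' ≤ _)
  obtain ⟨m, rfl⟩ := hle (hadd ▸ le_add_self : e'' ≤ _)
  have hnm : n + m = k := single_injective α (by rwa [single_add])
  rw [hwt, Int.natCast_dvd_natCast] at h'
  rw [single_eq_zero, single_eq_zero]
  rcases Nat.eq_zero_or_pos n with hn | hn
  · exact Or.inl hn
  · have := Nat.le_of_dvd hn h'
    omega

theorem exists_isIrreducibleMod_le {k : ℕ} {e : σ →₀ ℕ} {j : σ} (hk : (k : ℤ) ∣ weight a e)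
    (hj : e j = 1) : ∃ e' ≤ e, e' j = 1 ∧ IsIrreducibleMod a k e' := by
  obtain ⟨d, hde, ⟨hdj, hdk⟩, hmin⟩ := exists_minimal_le_of_wellFoundedLT
    (fun d : σ →₀ ℕ => d j = 1 ∧ (k : ℤ) ∣ weight a d) e ⟨hj, hk⟩
  have hzero {d' d'' : σ →₀ ℕ} (hd' : (k : ℤ) ∣ weight a d') (hadd : d' + d'' = d)
      (hj' : d' j = 1) : d'' = 0 := by
    have hle := hmin ⟨hj', hd'⟩ (hadd ▸ le_self_add)
    rw [← hadd] at hle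
    simpa using hle
  refine ⟨d, hde, hdj, fun h => by simp [h] at hdj, hdk, fun d' d'' h' h'' hadd => ?_⟩
  have hsum : d' j + d'' j = 1 := by rw [← Finsupp.add_apply, hadd, hdj]
  rcases (by omega : d' j = 1 ∨ d'' j = 1) with hj' | hj'
  · exact Or.inr (hzero h' hadd hj')
  · exact Or.inl (hzero h'' (by rw [add_comm, hadd]) hj')

theorem exists_isIrreducibleMod_apply_eq_one (k : ℕ) {α β j : σ} (hα : a α = 1) (hβ : a β = -1)
    (hjα : j ≠ α) (hjβ : j ≠ β) : ∃ e, IsIrreducibleMod a k e ∧ e j = 1 ∧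
      ∀ i, i ≠ α → i ≠ β → e i = single j 1 i := by
  classical
  obtain ⟨e, hle, hej, he⟩ := exists_isIrreducibleMod_le (a := a) (k := k) (j := j)
    (e := single j 1 + single β (a j).toNat + single α (-a j).toNat)
    (by
      have hw : a j + (a j).toNat * -1 + (-a j).toNat * 1 = 0 := by omega
      simp [weight_single, hα, hβ] at hw ⊢
      simp [hw]) (by simp [hjα.symm, hjβ.symm])
  refine ⟨e, he, hej, fun i hiα hiβ => ?_⟩
  rcases eq_or_ne i j with rfl | hij
  · simpa using hej
  · simpa [hiα.symm, hiβ.symm, hij.symm] using hle i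

theorem exists_injective_isIrreducibleMod {k : ℕ} (hk : k ≠ 1) {α₁ α₂ β₁ β₂ : σ} (hα : α₁ ≠ α₂)
    (hβ : β₁ ≠ β₂) (hα₁ : a α₁ = 1) (hα₂ : a α₂ = 1) (hβ₁ : a β₁ = -1) (hβ₂ : a β₂ = -1) :
    ∃ E : σ → σ →₀ ℕ, Function.Injective E ∧ ∀ j, IsIrreducibleMod a k (E j) ∧
      E j ∈ supported ℕ ℕ {j, α₁, α₂, β₁, β₂} ∧ E j ∉ supported ℕ ℕ {α₁} := by
  classical
  have hαβ {α β : σ} (hα : a α = 1) (hβ : a β = -1) : α ≠ β := by rintro rfl; omega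
  -- Away from `α₁` and `β₁` the exponents are `0`, `α₂ + β₂` and the `single j 1`, all distinct.
  let R (j : σ) : σ →₀ ℕ :=
    if j = α₁ then 0 else if j = β₁ then single α₂ 1 + single β₂ 1 else single j 1
  have hR : Function.Injective R := by
    intro j l h
    have hdeg := congrArg degree h
    simp only [R] at h hdeg
    split_ifs at h hdeg <;>
      first | (simp at hdeg; done) | simp_all [single_left_inj]
  have hR0 (j i : σ) (hi : i = α₁ ∨ i = β₁) : R j i = 0 := by
    have hβα := (hαβ hα₁ hβ₂).symm
    have hαβ := hαβ hα₂ hβ₁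
    simp only [R]
    split_ifs <;> rcases hi with rfl | rfl <;> simp_all
  have hex (j : σ) : ∃ e, IsIrreducibleMod a k e ∧ (∀ i, i ≠ α₁ → i ≠ β₁ → e i = R j i) ∧
      ∃ i ≠ α₁, e i ≠ 0 := by
    rcases eq_or_ne j α₁ with rfl | hjα
    · refine ⟨_, isIrreducibleMod_single_add_single hk hα₁ hβ₁, fun i hiα hiβ => ?_, β₁,
        (hαβ hα₁ hβ₁).symm, by simp⟩
      simp [R, hiα.symm, hiβ.symm]
    rcases eq_or_ne j β₁ with rfl | hjβ
    · exact ⟨_, isIrreducibleMod_single_add_single hk hα₂ hβ₂, fun i _ _ => by simp [R, hjα], α₂,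
        hα.symm, by simp⟩
    · obtain ⟨e, he, hej, heq⟩ := exists_isIrreducibleMod_apply_eq_one k hα₁ hβ₁ hjα hjβ
      exact ⟨e, he, by simpa [R, hjα, hjβ] using heq, j, hjα, by simp [hej]⟩
  choose E hE hER hEα using hex
  refine ⟨E, fun j l h => hR (Finsupp.ext fun i => ?_), fun j => ⟨hE j, ?_, fun hmem => ?_⟩⟩
  · by_cases hi : i = α₁ ∨ i = β₁
    · rw [hR0 j i hi, hR0 l i hi]
    · rw [not_or] at hi
      rw [← hER j i hi.1 hi.2, h, hER l i hi.1 hi.2]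
  · refine (mem_supported' ℕ _).2 fun i hi => ?_
    simp only [Set.mem_insert_iff, Set.mem_singleton_iff, not_or] at hi
    rw [hER j i hi.2.1 hi.2.2.2.1]
    simp only [R]
    split_ifs <;> simp [hi]
  · obtain ⟨i, hi, hEi⟩ := hEα j
    exact hEi ((mem_supported' ℕ _).1 hmem i hi)

end Exponents

/-! ### Singular points of the quotient -/

section Singular

open MvPolynomial

variable {σ : Type*} {a : σ → ℤ}

variable (a) in
/-- The linear functional on the invariants with prescribed values on the invariant monomials. -/
def monomialFunctional (c : (σ →₀ ℕ) → ℂ) : torusInvariants a →ₗ[ℂ] ℂ :=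
  (basisMonomials σ ℂ).constr ℂ c ∘ₗ (torusInvariants a).val.toLinearMap

@[simp]
theorem monomialFunctional_invariantMonomial (c : (σ →₀ ℕ) → ℂ) (d : invariantExponents a) :
    monomialFunctional a c (invariantMonomial d) = c d := by
  simpa [monomialFunctional] using (basisMonomials σ ℂ).constr_basis ℂ c d

theorem mem_pointDerivations_of_invariantMonomial {x : ComplexPoints (torusInvariants a)}
    {D : torusInvariants a →ₗ[ℂ] ℂ}
    (h : ∀ d e, D (invariantMonomial (d + e)) =
      x.eval (invariantMonomial d) * D (invariantMonomial e) +
        D (invariantMonomial d) * x.eval (invariantMonomial e)) : D ∈ pointDerivations x := by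
  let ψ : torusInvariants a →ₐ[ℂ] ℂ := x
  have hbilin : (LinearMap.mul ℂ (torusInvariants a)).compr₂ D =
      (LinearMap.mul ℂ ℂ).compl₁₂ ψ.toLinearMap D + (LinearMap.mul ℂ ℂ).compl₁₂ D ψ.toLinearMap :=
    torusInvariants_linearMap_ext fun d => torusInvariants_linearMap_ext fun e => by
      have hde : D (invariantMonomial (d + e)) = ψ (invariantMonomial d) * D (invariantMonomial e) +
        D (invariantMonomial d) * ψ (invariantMonomial e) := h d e
      simpa [invariantMonomial_add] using hde
  exact fun f g => LinearMap.congr_fun₂ hbilin f g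

open Classical in
/-- The part of an exponent at the coordinates that vanish at `v`. -/
def vanishingPart (v : σ → ℂ) (b : σ →₀ ℕ) : σ →₀ ℕ := b.filter fun i => v i = 0

theorem vanishingPart_add (v : σ → ℂ) (b c : σ →₀ ℕ) :
    vanishingPart v (b + c) = vanishingPart v b + vanishingPart v c :=
  Finsupp.filter_add

theorem vanishingPart_eq_zero_iff {v : σ → ℂ} {b : σ →₀ ℕ} :
    vanishingPart v b = 0 ↔ b ∈ Finsupp.supported ℕ ℕ {i | v i ≠ 0} := by
  simp [vanishingPart, Finsupp.filter_eq_zero_iff, Finsupp.mem_supported']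

theorem vanishingPart_eq_self_iff {v : σ → ℂ} {b : σ →₀ ℕ} :
    vanishingPart v b = b ↔ b ∈ Finsupp.supported ℕ ℕ {i | v i = 0} := by
  simp [vanishingPart, Finsupp.filter_eq_self_iff, Finsupp.mem_supported', not_imp_comm]

theorem dvd_weight_vanishingPart {v : σ → ℂ} {k : ℕ} (hk : IsStabilizerOrder a {i | v i ≠ 0} k)
    (b : invariantExponents a) : (k : ℤ) ∣ Finsupp.weight a (vanishingPart v b) := by
  classical
  have hb : Finsupp.weight a (vanishingPart v b) +
      Finsupp.weight a ((b : σ →₀ ℕ).filter fun i => v i ≠ 0) = 0 := by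
    rw [← map_add, vanishingPart, Finsupp.filter_add_filter_not]
    exact b.2
  rw [eq_neg_of_add_eq_zero_left hb, dvd_neg, ← hk]
  exact ⟨_, (Finsupp.mem_supported' _ _).2 fun i hi => Finsupp.filter_apply_neg _ _ hi, rfl⟩

open Classical in
/-- The value at `v` of the monomial with exponent `b`, ignoring the vanishing coordinates. -/
def nonvanishingValue (v : σ → ℂ) (b : σ →₀ ℕ) : ℂ :=
  b.prod fun i n => (if v i = 0 then 1 else v i) ^ n

theorem nonvanishingValue_add (v : σ → ℂ) (b c : σ →₀ ℕ) :
    nonvanishingValue v (b + c) = nonvanishingValue v b * nonvanishingValue v c :=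
  Finsupp.prod_add_index' (fun _ => pow_zero _) fun _ => pow_add _

theorem nonvanishingValue_ne_zero (v : σ → ℂ) (b : σ →₀ ℕ) : nonvanishingValue v b ≠ 0 := by
  refine Finset.prod_ne_zero_iff.2 fun i _ => pow_ne_zero _ ?_
  split_ifs with h
  exacts [one_ne_zero, h]

open Classical in
theorem eval_evalPoint_invariantMonomial (v : σ → ℂ) (b : invariantExponents a) :
    (evalPoint a v).eval (invariantMonomial b) =
      if vanishingPart v b = 0 then nonvanishingValue v b else 0 := by
  rw [eval_evalPoint, coe_invariantMonomial, aeval_monomial, map_one, one_mul]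
  split_ifs with h
  · rw [vanishingPart_eq_zero_iff] at h
    exact Finset.prod_congr rfl fun i hi => by simp [show v i ≠ 0 from h hi]
  · rw [vanishingPart_eq_zero_iff, Finsupp.mem_supported, Set.not_subset] at h
    obtain ⟨i, hi, hv⟩ := h
    exact Finset.prod_eq_zero hi (by
      simpa [not_not.1 hv] using hi)

open Classical in
variable (a) in
/-- The point derivation at the image of `v` induced by the vector field `X i ∂/∂X i`, which is
tangent to the stratum of the points with the same nonvanishing coordinates as `v`. -/
def tangentDerivation (v : σ → ℂ) (i : σ) : torusInvariants a →ₗ[ℂ] ℂ :=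
  monomialFunctional a fun b => if vanishingPart v b = 0 then b i * nonvanishingValue v b else 0

open Classical in
variable (a) in
/-- The functional that reads off the monomials with vanishing part `e`. It is a point derivation at
the image of `v` if `e` is irreducible. -/
def transverseDerivation (v : σ → ℂ) (e : σ →₀ ℕ) : torusInvariants a →ₗ[ℂ] ℂ :=
  monomialFunctional a fun b => if vanishingPart v b = e then nonvanishingValue v b else 0

theorem tangentDerivation_mem_pointDerivations (v : σ → ℂ) (i : σ) :
    tangentDerivation a v i ∈ pointDerivations (evalPoint a v) := by
  refine mem_pointDerivations_of_invariantMonomial fun d e => ?_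
  classical
  rw [eval_evalPoint_invariantMonomial, eval_evalPoint_invariantMonomial]
  simp only [tangentDerivation, monomialFunctional_invariantMonomial, AddSubmonoid.coe_add,
    vanishingPart_add, nonvanishingValue_add, add_eq_zero, Finsupp.add_apply, Nat.cast_add]
  by_cases hd : vanishingPart v d = 0 <;> by_cases he : vanishingPart v e = 0 <;>
    simp only [hd, he, and_self, and_false, false_and, if_true, if_false] <;> ring

theorem transverseDerivation_mem_pointDerivations {v : σ → ℂ} {k : ℕ}
    (hk : IsStabilizerOrder a {i | v i ≠ 0} k) {e : σ →₀ ℕ} (he : IsIrreducibleMod a k e) :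
    transverseDerivation a v e ∈ pointDerivations (evalPoint a v) := by
  refine mem_pointDerivations_of_invariantMonomial fun b b' => ?_
  classical
  rw [eval_evalPoint_invariantMonomial, eval_evalPoint_invariantMonomial]
  simp only [transverseDerivation, monomialFunctional_invariantMonomial, AddSubmonoid.coe_add,
    vanishingPart_add, nonvanishingValue_add]
  have hirr := he.2.2 _ _ (dvd_weight_vanishingPart hk b) (dvd_weight_vanishingPart hk b')
  have he0 := he.1.symm
  by_cases hb : vanishingPart v b = 0 <;> by_cases hb' : vanishingPart v b' = 0
  · simp [hb, hb', he0]
  · simp [hb, hb', he0]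
  · simp [hb, hb', he0]
  · have hne : vanishingPart v b + vanishingPart v b' ≠ e := fun h => (hirr h).elim hb hb'
    simp [hb, hb', hne]

theorem linearIndepOn_transverseDerivation {v : σ → ℂ} {T : Set (σ →₀ ℕ)}
    (hT : ∀ e ∈ T, ∃ b ∈ invariantExponents a, vanishingPart v b = e) :
    LinearIndepOn ℂ (transverseDerivation a v) T := by
  choose! b hb hbe using hT
  refine LinearIndependent.of_pairwise_dual_eq_zero_one _
    (fun e : T => (nonvanishingValue v (b e))⁻¹ •
      LinearMap.applyₗ (invariantMonomial ⟨b e, hb e e.2⟩)) (fun e e' hne => ?_) fun e => ?_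
  · have hne' : (e : σ →₀ ℕ) ≠ e' := Subtype.coe_ne_coe.2 hne
    simp [transverseDerivation, hbe e e.2, hne']
  · simp [transverseDerivation, hbe e e.2, nonvanishingValue_ne_zero]

theorem linearIndepOn_tangentDerivation [Finite σ] {v : σ → ℂ} {K : Set σ}
    (hK : ∀ c ∈ Finsupp.supported ℂ ℂ K, (∀ b ∈ invariantExponents a,
      b ∈ Finsupp.supported ℕ ℕ {i | v i ≠ 0} → Finsupp.weight c b = 0) → c = 0) :
    LinearIndepOn ℂ (tangentDerivation a v) K := by
  have := Fintype.ofFinite σ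
  refine linearIndepOn_iff.2 fun c hc h0 => hK c hc fun b hb hbv => ?_
  have happ := LinearMap.congr_fun h0 (invariantMonomial ⟨b, hb⟩)
  have hsum : ∑ i, c i * (b i * nonvanishingValue v b) = 0 := by
    simpa [Finsupp.linearCombination_apply, Finsupp.sum_fintype, tangentDerivation,
      vanishingPart_eq_zero_iff.2 hbv] using happ
  refine (mul_eq_zero.1 ?_).resolve_right (nonvanishingValue_ne_zero v b)
  rw [← hsum, Finsupp.weight_eq_sum, Finset.sum_mul]
  exact Finset.sum_congr rfl fun i _ => by rw [nsmul_eq_mul]; ring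

theorem disjoint_span_transverseDerivation_span_tangentDerivation (v : σ → ℂ) {T : Set (σ →₀ ℕ)}
    (hT : 0 ∉ T) (K : Set σ) :
    Disjoint (Submodule.span ℂ (Set.range fun e : T => transverseDerivation a v e))
      (Submodule.span ℂ (Set.range fun i : K => tangentDerivation a v i)) := by
  refine Submodule.disjoint_def.2 fun D hD hD' => torusInvariants_linearMap_ext fun b => ?_
  let atMonomial := LinearMap.applyₗ (R := ℂ) (M₂ := ℂ) (invariantMonomial b)
  suffices D ∈ LinearMap.ker atMonomial from this
  by_cases hb : vanishingPart v b = 0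
  · refine Submodule.span_le.2 ?_ hD
    rintro _ ⟨e, rfl⟩
    have he : (0 : σ →₀ ℕ) ≠ e := (ne_of_mem_of_not_mem e.2 hT).symm
    simp [atMonomial, transverseDerivation, hb, he]
  · refine Submodule.span_le.2 ?_ hD'
    rintro _ ⟨i, rfl⟩
    simp [atMonomial, tangentDerivation, hb]

theorem ncard_add_ncard_lt_of_notMem_singularLocus [Finite σ] {α : σ} (hα : a α ≠ 0) {v : σ → ℂ}
    (hreg : evalPoint a v ∉ singularLocus (torusInvariants a)) {k : ℕ}
    (hk : IsStabilizerOrder a {i | v i ≠ 0} k) {T : Set (σ →₀ ℕ)} (hTfin : T.Finite)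
    (hT : ∀ e ∈ T, IsIrreducibleMod a k e ∧ e ∈ Finsupp.supported ℕ ℕ {i | v i = 0}) {K : Set σ}
    (hK : ∀ c ∈ Finsupp.supported ℂ ℂ K, (∀ b ∈ invariantExponents a,
      b ∈ Finsupp.supported ℕ ℕ {i | v i ≠ 0} → Finsupp.weight c b = 0) → c = 0) :
    T.ncard + K.ncard < Nat.card σ := by
  have hatt : ∀ e ∈ T, ∃ b ∈ invariantExponents a, vanishingPart v b = e := fun e he => by
    obtain ⟨u, hu, heu⟩ := hk.exists_add_mem (hT e he).1.2.1
    refine ⟨_, heu, ?_⟩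
    rw [vanishingPart_add, vanishingPart_eq_self_iff.2 (hT e he).2,
      vanishingPart_eq_zero_iff.2 hu, add_zero]
  have hli := (linearIndepOn_transverseDerivation hatt).sum_type
    (linearIndepOn_tangentDerivation hK)
    (disjoint_span_transverseDerivation_span_tangentDerivation v (fun h => (hT 0 h).1.1 rfl) K)
  have := hTfin.to_subtype
  have hcard := natCard_le_of_notMem_singularLocus hreg (ringKrullDim_torusInvariants_le hα)
    (Sum.rec (fun e => transverseDerivation_mem_pointDerivations hk (hT e e.2).1)
      fun i => tangentDerivation_mem_pointDerivations v i) hli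
  rw [Nat.card_sum, Nat.card_coe_set_eq, Nat.card_coe_set_eq] at hcard
  have : 0 < Nat.card σ := Nat.card_pos_iff.2 ⟨⟨α⟩, inferInstance⟩
  omega

theorem exists_eq_mul_of_forall_weight_eq_zero {I : Set σ} (hpos : ∃ i ∈ I, 0 < a i)
    (hneg : ∃ i ∈ I, a i < 0) {c : σ → ℂ} (hc : ∀ b ∈ invariantExponents a,
      b ∈ Finsupp.supported ℕ ℕ I → Finsupp.weight c b = 0) : ∃ μ : ℂ, ∀ i ∈ I, c i = μ * a i := by
  have hrel {i j : σ} (hi : i ∈ I) (hj : j ∈ I) (hai : 0 ≤ a i) (haj : a j ≤ 0) :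
      c i * a j = c j * a i := by
    have h := hc (Finsupp.single i (-a j).toNat + Finsupp.single j (a i).toNat)
      (by
        rw [mem_invariantExponents, map_add, Finsupp.weight_single, Finsupp.weight_single,
          nsmul_eq_mul, nsmul_eq_mul, Int.toNat_of_nonneg hai, Int.toNat_of_nonneg (by omega)]
        ring)
      (add_mem (Finsupp.single_mem_supported ℕ _ hi) (Finsupp.single_mem_supported ℕ _ hj))
    have hcast {z : ℤ} (hz : 0 ≤ z) : ((z.toNat : ℕ) : ℂ) = z := by
      exact_mod_cast congrArg (Int.cast : ℤ → ℂ) (Int.toNat_of_nonneg hz)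
    rw [map_add, Finsupp.weight_single, Finsupp.weight_single, nsmul_eq_mul, nsmul_eq_mul,
      hcast hai, hcast (by omega)] at h
    push_cast at h
    linear_combination -h
  obtain ⟨p, hp, hp0⟩ := hpos
  obtain ⟨n, hn, hn0⟩ := hneg
  have hap : (a p : ℂ) ≠ 0 := by exact_mod_cast hp0.ne'
  have han : (a n : ℂ) ≠ 0 := by exact_mod_cast hn0.ne
  refine ⟨c p / a p, fun i hi => ?_⟩
  rw [div_mul_eq_mul_div, eq_div_iff hap]
  rcases le_total (a i) 0 with h | h
  · exact (hrel hp hi hp0.le h).symm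
  · refine mul_right_cancel₀ han ?_
    linear_combination (a p : ℂ) * hrel hi hn h hn0.le - (a i : ℂ) * hrel hp hn hp0.le hn0.le

theorem eq_zero_of_weight_eq_zero_of_isStabilizerOrder_zero {I : Set σ}
    (hI : IsStabilizerOrder a I 0) {c : σ →₀ ℂ} (hcI : c ∈ Finsupp.supported ℂ ℂ I)
    (hc : ∀ b ∈ invariantExponents a, b ∈ Finsupp.supported ℕ ℕ I → Finsupp.weight c b = 0) :
    c = 0 := by
  ext i
  by_cases hi : i ∈ I
  · have hai : a i = 0 := by simpa using hI.dvd hi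
    simpa [Finsupp.weight_single] using hc (Finsupp.single i 1)
      (by simp [mem_invariantExponents, Finsupp.weight_single, hai])
      (Finsupp.single_mem_supported ℕ 1 hi)
  · exact (Finsupp.mem_supported' ℂ c).1 hcI i hi

theorem eq_zero_of_weight_eq_zero_of_isStabilizerOrder {I : Set σ} {k : ℕ} (hk : k ≠ 0)
    (hI : IsStabilizerOrder a I k) {i₀ : σ} (hi₀ : i₀ ∈ I) (hpos : 0 < a i₀) {c : σ →₀ ℂ}
    (hcI : c ∈ Finsupp.supported ℂ ℂ (I \ {i₀}))
    (hc : ∀ b ∈ invariantExponents a, b ∈ Finsupp.supported ℕ ℕ I → Finsupp.weight c b = 0) :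
    c = 0 := by
  rw [Finsupp.mem_supported'] at hcI
  obtain ⟨μ, hμ⟩ := exists_eq_mul_of_forall_weight_eq_zero ⟨i₀, hi₀, hpos⟩ (hI.exists_neg hk) hc
  have hμ0 : μ = 0 := by
    have h := hμ i₀ hi₀
    rw [hcI i₀ (fun h => h.2 rfl), zero_eq_mul] at h
    exact h.resolve_right (by exact_mod_cast hpos.ne')
  ext i
  by_cases hi : i ∈ I
  · simpa [hμ0] using hμ i hi
  · exact hcI i fun h => hi h.1

theorem evalPoint_mem_singularLocus_of_isStabilizerOrder [Finite σ] {α₁ α₂ β₁ β₂ : σ}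
    (hα : α₁ ≠ α₂) (hβ : β₁ ≠ β₂) (hα₁ : a α₁ = 1) (hα₂ : a α₂ = 1) (hβ₁ : a β₁ = -1)
    (hβ₂ : a β₂ = -1) {v : σ → ℂ} {k : ℕ} (hk : IsStabilizerOrder a {i | v i ≠ 0} k)
    (hk1 : k ≠ 1) : evalPoint a v ∈ singularLocus (torusInvariants a) := by
  by_contra hreg
  have hzero {i : σ} (hi : a i = 1 ∨ a i = -1) : v i = 0 := by
    by_contra hv
    have hdvd : k ∣ (a i).natAbs := Int.natCast_dvd.1 (hk.dvd hv)
    exact hk1 (Nat.dvd_one.1 (by rcases hi with hi | hi <;> simpa [hi] using hdvd))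
  obtain ⟨E, hE, hEirr⟩ := exists_injective_isIrreducibleMod hk1 hα hβ hα₁ hα₂ hβ₁ hβ₂
  let T : Set (σ →₀ ℕ) := E '' {j | v j = 0}
  have hT : ∀ e ∈ T, IsIrreducibleMod a k e ∧ e ∈ Finsupp.supported ℕ ℕ {i | v i = 0} := by
    rintro _ ⟨j, hj, rfl⟩
    refine ⟨(hEirr j).1, Finsupp.supported_mono ?_ (hEirr j).2.1⟩
    rintro i (rfl | rfl | rfl | rfl | rfl)
    exacts [hj, hzero (Or.inl hα₁), hzero (Or.inl hα₂), hzero (Or.inr hβ₁), hzero (Or.inr hβ₂)]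
  have hTfin : T.Finite := (Set.toFinite _).image E
  have hTcard : T.ncard + {i | v i ≠ 0}.ncard = Nat.card σ := by
    rw [Set.ncard_image_of_injective _ hE]
    exact Set.ncard_add_ncard_compl _
  rcases eq_or_ne k 0 with rfl | hk0
  · exact (ncard_add_ncard_lt_of_notMem_singularLocus (α := α₁) (by omega) hreg hk hTfin hT fun c =>
      eq_zero_of_weight_eq_zero_of_isStabilizerOrder_zero hk).ne hTcard
  · obtain ⟨i₀, hi₀, hpos⟩ := hk.exists_pos hk0
    have hT' : ∀ e ∈ insert (Finsupp.single α₁ k) T, IsIrreducibleMod a k e ∧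
        e ∈ Finsupp.supported ℕ ℕ {i | v i = 0} :=
      Set.forall_mem_insert.2 ⟨⟨isIrreducibleMod_single hk0 hα₁,
        Finsupp.single_mem_supported ℕ k (hzero (Or.inl hα₁))⟩, hT⟩
    have hpow : Finsupp.single α₁ k ∉ T := by
      rintro ⟨j, -, hj⟩
      exact (hEirr j).2.2 (hj ▸ Finsupp.single_mem_supported ℕ k rfl)
    have hKcard := Set.ncard_sdiff_singleton_add_one hi₀
    have hlt := ncard_add_ncard_lt_of_notMem_singularLocus (α := α₁) (by omega) hreg hk
      (hTfin.insert _) hT' fun c => eq_zero_of_weight_eq_zero_of_isStabilizerOrder hk0 hk hi₀ hpos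
    rw [Set.ncard_insert_of_notMem hpow hTfin] at hlt
    omega

end Singular

/-! ### Regular points of the quotient -/

section MaximalIdeals

open MvPolynomial

theorem ker_aeval_eq_span {σ : Type*} (v : σ → ℂ) :
    RingHom.ker (aeval v : MvPolynomial σ ℂ →ₐ[ℂ] ℂ) =
      Ideal.span (Set.range fun i => (X i - C (v i) : MvPolynomial σ ℂ)) := by
  refine le_antisymm (fun f hf => ?_) (Ideal.span_le.2 ?_)
  · set I := Ideal.span (Set.range fun i => (X i - C (v i) : MvPolynomial σ ℂ))
    have hmk : Ideal.Quotient.mkₐ ℂ I =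
        (Algebra.ofId ℂ (MvPolynomial σ ℂ ⧸ I)).comp (aeval v) := by
      ext i
      rw [AlgHom.comp_apply, aeval_X]
      exact Ideal.Quotient.mk_eq_mk_iff_sub_mem _ _ |>.2 (Ideal.subset_span ⟨i, rfl⟩)
    rw [← Ideal.Quotient.eq_zero_iff_mem, ← Ideal.Quotient.mkₐ_eq_mk ℂ, hmk, AlgHom.comp_apply,
      show aeval v f = 0 from hf, map_zero]
  · rintro _ ⟨i, rfl⟩
    simp [RingHom.mem_ker]

theorem natCard_le_height_ker_aeval {σ : Type*} [Finite σ] (v : σ → ℂ) :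
    (Nat.card σ : ℕ∞) ≤ (RingHom.ker (aeval v : MvPolynomial σ ℂ →ₐ[ℂ] ℂ)).height := by
  classical
  have := RingHom.ker_isPrime (aeval v : MvPolynomial σ ℂ →ₐ[ℂ] ℂ)
  have := isRegularRing_iff.1 (inferInstanceAs (IsRegularRing (MvPolynomial σ ℂ)))
    (RingHom.ker (aeval v : MvPolynomial σ ℂ →ₐ[ℂ] ℂ))
  refine natCard_le_height_ker (aeval v)
    (D := fun i => (aeval v).toLinearMap ∘ₗ (pderiv i).toLinearMap) (fun i f g => ?_) ?_
  · simp [mul_comm]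
  · have hX : (fun i => LinearMap.pi (fun j => LinearMap.applyₗ (X j : MvPolynomial σ ℂ))
        ((aeval v).toLinearMap ∘ₗ (pderiv i).toLinearMap)) = fun i => Pi.single i (1 : ℂ) := by
      ext i j
      simp [pderiv_X, Pi.single_apply, eq_comm]
    exact LinearIndependent.of_comp _ (hX ▸ Pi.linearIndependent_single_one σ ℂ)

theorem mem_sq_ker_aeval {σ : Type*} [Finite σ] {v : σ → ℂ} {f : MvPolynomial σ ℂ}
    (hf : aeval v f = 0) (hd : ∀ i, aeval v (pderiv i f) = 0) :
    f ∈ RingHom.ker (aeval v : MvPolynomial σ ℂ →ₐ[ℂ] ℂ) ^ 2 := by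
  classical
  have := Fintype.ofFinite σ
  have hmem : f ∈ RingHom.ker (aeval v : MvPolynomial σ ℂ →ₐ[ℂ] ℂ) := hf
  rw [ker_aeval_eq_span, Ideal.mem_span_range_iff_exists_fun] at hmem
  obtain ⟨c, rfl⟩ := hmem
  have hc (i : σ) : aeval v (c i) = 0 := by
    simpa [Derivation.leibniz, pderiv_X, Pi.single_apply, apply_ite] using hd i
  rw [pow_two]
  exact Ideal.sum_mem _ fun i _ => Ideal.mul_mem_mul (hc i) (by simp [RingHom.mem_ker])

theorem height_le_height_add_one {R S : Type*} [CommRing R] [CommRing S] [Algebra R S]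
    [IsNoetherianRing R] [IsNoetherianRing S] (p : Ideal R) [p.IsPrime] (P : Ideal S) [P.IsPrime]
    [P.LiesOver p] {f : S} (hf : P = p.map (algebraMap R S) ⊔ Ideal.span {f}) :
    P.height ≤ p.height + 1 := by
  set J := p.map (algebraMap R S)
  refine (Ideal.height_le_height_add_of_liesOver p P).trans (add_le_add_right ?_ _)
  have hmap : P.map (Ideal.Quotient.mk J) = Ideal.span {Ideal.Quotient.mk J f} := by
    rw [hf, Ideal.map_sup, Ideal.map_quotient_self, bot_sup_eq, Ideal.map_span,
      Set.image_singleton]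
  have hJP : RingHom.ker (Ideal.Quotient.mk J) ≤ P := by
    rw [Ideal.mk_ker, hf]
    exact le_sup_left
  have hprime := Ideal.map_isPrime_of_surjective Ideal.Quotient.mk_surjective hJP
  refine (Ideal.height_le_spanFinrank _ hprime.ne_top).trans ?_
  rw [hmap]
  simpa using Submodule.spanFinrank_span_le_encard (R := S ⧸ J) {Ideal.Quotient.mk J f}

theorem spanFinrank_maximalIdeal_le_finrank_map {k A W S : Type*} [Field k] [CommRing A]
    [Algebra k A] [AddCommGroup W] [Module k W] [FiniteDimensional k W] [CommRing S]
    [IsLocalRing S] [IsNoetherianRing S] [Algebra A S] {p : Ideal A}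
    (hp : p.map (algebraMap A S) = IsLocalRing.maximalIdeal S) (d : A →ₗ[k] W)
    (hd : ∀ h ∈ p, d h = 0 → algebraMap A S h ∈ IsLocalRing.maximalIdeal S ^ 2) :
    (IsLocalRing.maximalIdeal S).spanFinrank ≤
      Module.finrank k ((p.restrictScalars k).map d) := by
  let b := Module.finBasis k ((p.restrictScalars k).map d)
  choose e hep heb using fun j => (b j).2
  let J := Ideal.span (Set.range fun j => algebraMap A S (e j))
  have hJ {h : A} (hh : h ∈ Submodule.span k (Set.range e)) : h ∈ p ∧ algebraMap A S h ∈ J := by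
    have hle : Submodule.span k (Set.range e) ≤
        ((p ⊓ J.comap (algebraMap A S)).restrictScalars k) := by
      refine Submodule.span_le.2 ?_
      rintro _ ⟨j, rfl⟩
      exact ⟨hep j, Ideal.subset_span ⟨j, rfl⟩⟩
    exact hle hh
  have hde : (Submodule.span k (Set.range e)).map d = (p.restrictScalars k).map d := by
    have hrange : d '' Set.range e = Submodule.subtype _ '' Set.range b := by
      rw [← Set.range_comp, ← Set.range_comp]
      exact congrArg Set.range (funext heb)
    rw [Submodule.map_span, hrange, ← Submodule.map_span, b.span_eq, Submodule.map_subtype_top]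
  have hle : IsLocalRing.maximalIdeal S ≤ J := by
    refine Submodule.le_of_le_smul_of_le_jacobson_bot (IsNoetherian.noetherian _)
      (IsLocalRing.maximalIdeal_le_jacobson _) (hp.ge.trans (Ideal.map_le_iff_le_comap.2 ?_))
    intro h hh
    obtain ⟨h', hh', hdh⟩ : d h ∈ (Submodule.span k (Set.range e)).map d :=
      hde.ge (Submodule.mem_map_of_mem hh)
    rw [Ideal.mem_comap, ← add_sub_cancel h' h, map_add, smul_eq_mul, ← pow_two]
    exact Submodule.add_mem_sup (hJ hh').2
      (hd _ (p.sub_mem hh (hJ hh').1) (by rw [map_sub, hdh, sub_self]))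
  have heq : IsLocalRing.maximalIdeal S = J :=
    le_antisymm hle (Ideal.span_le.2 (Set.range_subset_iff.2 fun j =>
      hp ▸ Ideal.mem_map_of_mem _ (hep j)))
  rw [heq]
  refine (Submodule.spanFinrank_span_le_ncard_of_finite (Set.finite_range _)).trans ?_
  rw [← Set.image_univ]
  exact (Set.ncard_image_le Set.finite_univ).trans (by simp)

end MaximalIdeals

section RegularPoints

open MvPolynomial

variable {σ : Type*} {a : σ → ℤ}

variable (a) in
/-- The maximal ideal of the invariants that vanish at `v`. -/
def pointIdeal (v : σ → ℂ) : Ideal (torusInvariants a) :=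
  (evalPoint a v).toPrimeSpectrum.asIdeal

instance (v : σ → ℂ) : (pointIdeal a v).IsPrime := (evalPoint a v).toPrimeSpectrum.2

theorem mem_pointIdeal {v : σ → ℂ} {h : torusInvariants a} :
    h ∈ pointIdeal a v ↔ aeval v (h : MvPolynomial σ ℂ) = 0 := Iff.rfl

theorem aeval_monomial_ne_zero {v : σ → ℂ} {u : σ →₀ ℕ}
    (hu : u ∈ Finsupp.supported ℕ ℕ {i | v i ≠ 0}) : aeval v (monomial u (1 : ℂ)) ≠ 0 := by
  rw [aeval_monomial, map_one, one_mul]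
  exact Finset.prod_ne_zero_iff.2 fun i hi => pow_ne_zero _ (hu hi)

variable (a) in
/-- The gradient of an invariant at `v`. -/
def gradient (v : σ → ℂ) : torusInvariants a →ₗ[ℂ] (σ → ℂ) :=
  LinearMap.pi fun i =>
    (aeval v).toLinearMap ∘ₗ (pderiv i).toLinearMap ∘ₗ (torusInvariants a).val.toLinearMap

theorem gradient_apply (v : σ → ℂ) (h : torusInvariants a) (i : σ) :
    gradient a v h i = aeval v (pderiv i (h : MvPolynomial σ ℂ)) := rfl

theorem sum_weight_mul_gradient [Fintype σ] (v : σ → ℂ) (h : torusInvariants a) :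
    ∑ i, a i * v i * gradient a v h i = 0 := by
  let ℓ : torusInvariants a →ₗ[ℂ] ℂ :=
    ∑ i, (a i * v i : ℂ) • (LinearMap.proj i ∘ₗ gradient a v)
  suffices ℓ = 0 by simpa [ℓ] using LinearMap.congr_fun this h
  refine torusInvariants_linearMap_ext fun d => ?_
  have hd : ∑ i, ((d : σ →₀ ℕ) i : ℤ) * a i = 0 := by
    simpa [Finsupp.weight_eq_sum] using mem_invariantExponents.1 d.2
  have hi (i : σ) : a i * v i * gradient a v (invariantMonomial d) i =
      (((d : σ →₀ ℕ) i * a i : ℤ) : ℂ) * aeval v (monomial (d : σ →₀ ℕ) (1 : ℂ)) := by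
    have hX := congrArg (aeval v)
      (X_mul_pderiv_monomial (R := ℂ) (i := i) (m := (d : σ →₀ ℕ)) (r := 1))
    rw [map_mul, aeval_X, map_nsmul, nsmul_eq_mul] at hX
    rw [gradient_apply, coe_invariantMonomial, mul_assoc, hX]
    push_cast
    ring
  simp only [ℓ, LinearMap.sum_apply, LinearMap.smul_apply, LinearMap.comp_apply,
    LinearMap.proj_apply, smul_eq_mul, hi, LinearMap.zero_apply]
  rw [← Finset.sum_mul, ← Int.cast_sum, hd, Int.cast_zero, zero_mul]

theorem finrank_map_gradient_lt [Finite σ] {v : σ → ℂ} {i : σ} (hi : v i ≠ 0) (hai : a i ≠ 0)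
    (M : Submodule ℂ (torusInvariants a)) :
    Module.finrank ℂ (M.map (gradient a v)) < Nat.card σ := by
  classical
  have := Fintype.ofFinite σ
  let ℓ : (σ → ℂ) →ₗ[ℂ] ℂ := ∑ i, (a i * v i : ℂ) • LinearMap.proj i
  have hle : M.map (gradient a v) ≤ LinearMap.ker ℓ := by
    rintro _ ⟨h, -, rfl⟩
    simpa [ℓ] using sum_weight_mul_gradient v h
  have hℓ : LinearMap.ker ℓ ≠ ⊤ := fun h => by
    have hmem : Pi.single i 1 ∈ LinearMap.ker ℓ := h ▸ Submodule.mem_top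
    simp [ℓ, Pi.single_apply, hi, hai] at hmem
  simpa [Nat.card_eq_fintype_card] using
    (Submodule.finrank_mono hle).trans_lt (Submodule.finrank_lt hℓ)

section Balanced

variable {u w : σ →₀ ℕ} (hu : Finsupp.weight a u = 1) (hw : Finsupp.weight a w = -1)

/-- The invariant monomial obtained from `X i` by multiplication with powers of the monomials with
exponents `u` and `w`, which are semi-invariants of weights `1` and `-1`. -/
def balancedInvariant (i : σ) : torusInvariants a :=
  invariantMonomial ⟨Finsupp.single i 1 + (a i).toNat • w + (-a i).toNat • u, by
    rw [mem_invariantExponents, map_add, map_add, map_nsmul, map_nsmul, hu, hw,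
      Finsupp.weight_single, one_smul, nsmul_eq_mul, nsmul_eq_mul]
    omega⟩

/-- The product of the two semi-invariant monomials with exponents `u` and `w`. -/
def semiinvariantProduct : torusInvariants a :=
  invariantMonomial ⟨u + w, by rw [mem_invariantExponents, map_add, hu, hw]; rfl⟩

theorem coe_balancedInvariant (i : σ) : (balancedInvariant hu hw i : MvPolynomial σ ℂ) =
    X i * monomial w 1 ^ (a i).toNat * monomial u 1 ^ (-a i).toNat := by
  simp [balancedInvariant, monomial_pow, monomial_mul, X]

theorem coe_semiinvariantProduct :
    (semiinvariantProduct hu hw : MvPolynomial σ ℂ) = monomial u 1 * monomial w 1 := by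
  simp [semiinvariantProduct, monomial_mul]

theorem prod_balancedInvariant_pow (d : invariantExponents a) :
    (d : σ →₀ ℕ).prod (fun i n => balancedInvariant hu hw i ^ n) =
      invariantMonomial d *
        (d : σ →₀ ℕ).prod fun i n => (semiinvariantProduct hu hw ^ (a i).toNat) ^ n := by
  obtain ⟨d, hd⟩ := d
  have hsum : ∑ i ∈ d.support, (a i).toNat * d i = ∑ i ∈ d.support, (-a i).toNat * d i := by
    zify
    rw [← sub_eq_zero, ← Finset.sum_sub_distrib, ← mem_invariantExponents.1 hd,
      Finsupp.weight_apply, Finsupp.sum]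
    refine Finset.sum_congr rfl fun i _ => ?_
    rw [← sub_mul, show ((a i).toNat : ℤ) - ((-a i).toNat : ℤ) = a i by omega, nsmul_eq_mul,
      mul_comm]
  refine Subtype.ext ?_
  simp only [Finsupp.prod, MulMemClass.coe_mul, SubmonoidClass.coe_finsetProd,
    SubmonoidClass.coe_pow, coe_balancedInvariant, coe_semiinvariantProduct,
    coe_invariantMonomial, mul_pow, Finset.prod_mul_distrib, ← pow_mul,
    Finset.prod_pow_eq_pow_sum, ← prod_X_pow_eq_monomial, hsum]
  ring

theorem aeval_eq_algebraMap_of_mul_pow_eq {S : Type*} [CommRing S] [Algebra (torusInvariants a) S]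
    [Algebra ℂ S] [IsScalarTower ℂ (torusInvariants a) S]
    (hunit : IsUnit (algebraMap _ S (semiinvariantProduct hu hw))) {q : σ → S}
    (hq : ∀ i, q i * algebraMap _ S (semiinvariantProduct hu hw) ^ (a i).toNat =
      algebraMap _ S (balancedInvariant hu hw i)) (h : torusInvariants a) :
    aeval q (h : MvPolynomial σ ℂ) = algebraMap _ S h := by
  suffices (aeval q).toLinearMap ∘ₗ (torusInvariants a).val.toLinearMap =
      (IsScalarTower.toAlgHom ℂ (torusInvariants a) S).toLinearMap from LinearMap.congr_fun this h
  refine torusInvariants_linearMap_ext fun d => ?_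
  have hprod : IsUnit ((d : σ →₀ ℕ).prod fun i n =>
      (algebraMap _ S (semiinvariantProduct hu hw) ^ (a i).toNat) ^ n) :=
    IsUnit.prod_iff.2 fun i _ => (hunit.pow _).pow _
  refine hprod.mul_right_cancel ?_
  have hmap := congrArg (algebraMap _ S) (prod_balancedInvariant_pow hu hw d)
  simp only [Finsupp.prod, map_mul, map_prod, map_pow, ← hq, mul_pow,
    Finset.prod_mul_distrib] at hmap
  simpa [aeval_monomial, Finsupp.prod] using hmap

include hu hw in
theorem map_X_of_map_semiinvariant {B : Type*} [CommRing B] [Algebra ℂ B]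
    {φ : MvPolynomial σ ℂ →ₐ[ℂ] B} {v : σ → ℂ}
    (hφ : ∀ h : torusInvariants a, φ h = algebraMap ℂ B (aeval v (h : MvPolynomial σ ℂ)))
    (hφu : φ (monomial u 1) = algebraMap ℂ B (aeval v (monomial u (1 : ℂ))))
    (hvu : aeval v (monomial u (1 : ℂ)) ≠ 0) (hvw : aeval v (monomial w (1 : ℂ)) ≠ 0) (i : σ) :
    φ (X i) = algebraMap ℂ B (v i) := by
  have hunit {z : ℂ} (hz : z ≠ 0) : IsUnit (algebraMap ℂ B z) := (isUnit_iff_ne_zero.2 hz).map _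
  have hφw : φ (monomial w 1) = algebraMap ℂ B (aeval v (monomial w (1 : ℂ))) := by
    have h := hφ (semiinvariantProduct hu hw)
    rw [coe_semiinvariantProduct, map_mul, map_mul, map_mul, hφu] at h
    exact (hunit hvu).mul_left_cancel h
  have h := hφ (balancedInvariant hu hw i)
  simp only [coe_balancedInvariant, map_mul, map_pow, aeval_X, hφu, hφw] at h
  exact ((hunit hvw).pow _).mul_right_cancel (((hunit hvu).pow _).mul_right_cancel h)

include hu hw in
theorem ker_aeval_eq_sup {v : σ → ℂ} (hvu : aeval v (monomial u (1 : ℂ)) ≠ 0)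
    (hvw : aeval v (monomial w (1 : ℂ)) ≠ 0) :
    RingHom.ker (aeval v : MvPolynomial σ ℂ →ₐ[ℂ] ℂ) =
      (pointIdeal a v).map (algebraMap (torusInvariants a) (MvPolynomial σ ℂ)) ⊔
        Ideal.span {monomial u 1 - C (aeval v (monomial u (1 : ℂ)))} := by
  set Q := (pointIdeal a v).map (algebraMap (torusInvariants a) (MvPolynomial σ ℂ)) ⊔
    Ideal.span {monomial u 1 - C (aeval v (monomial u (1 : ℂ)))}
  refine le_antisymm ?_ (sup_le (Ideal.map_le_iff_le_comap.2 fun h hh => hh) ?_)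
  · rw [ker_aeval_eq_span, Ideal.span_le]
    rintro _ ⟨i, rfl⟩
    refine Ideal.Quotient.mk_eq_mk_iff_sub_mem _ _ |>.1
      (map_X_of_map_semiinvariant hu hw (φ := Ideal.Quotient.mkₐ ℂ Q) (fun h => ?_) ?_ hvu hvw i)
    · refine Ideal.Quotient.mk_eq_mk_iff_sub_mem _ _ |>.2 (Ideal.mem_sup_left ?_)
      have hmem : h - algebraMap ℂ _ (aeval v (h : MvPolynomial σ ℂ)) ∈ pointIdeal a v := by
        simp [mem_pointIdeal]
      exact Ideal.mem_map_of_mem (algebraMap _ (MvPolynomial σ ℂ)) hmem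
    · exact Ideal.Quotient.mk_eq_mk_iff_sub_mem _ _ |>.2
        (Ideal.mem_sup_right (Ideal.subset_span rfl))
  · rw [Ideal.span_le, Set.singleton_subset_iff]
    simp [RingHom.mem_ker]

include hu hw in
theorem natCard_le_height_pointIdeal_add_one [Finite σ] {v : σ → ℂ}
    (hvu : aeval v (monomial u (1 : ℂ)) ≠ 0) (hvw : aeval v (monomial w (1 : ℂ)) ≠ 0) :
    (Nat.card σ : ℕ∞) ≤ (pointIdeal a v).height + 1 := by
  have := RingHom.ker_isPrime (aeval v : MvPolynomial σ ℂ →ₐ[ℂ] ℂ)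
  have : (RingHom.ker (aeval v : MvPolynomial σ ℂ →ₐ[ℂ] ℂ)).LiesOver (pointIdeal a v) := ⟨rfl⟩
  exact (natCard_le_height_ker_aeval v).trans
    (height_le_height_add_one _ _ (ker_aeval_eq_sup hu hw hvu hvw))

include hu hw in
theorem exists_local_section {v : σ → ℂ} (hvu : aeval v (monomial u (1 : ℂ)) = 1)
    (hvw : aeval v (monomial w (1 : ℂ)) ≠ 0) (S : Type*) [CommRing S] [IsLocalRing S]
    [Algebra (torusInvariants a) S] [Algebra ℂ S] [IsScalarTower ℂ (torusInvariants a) S]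
    [IsLocalization.AtPrime S (pointIdeal a v)] :
    ∃ s : MvPolynomial σ ℂ →ₐ[ℂ] S,
      (∀ h : torusInvariants a, s (h : MvPolynomial σ ℂ) = algebraMap _ S h) ∧
      RingHom.ker (aeval v : MvPolynomial σ ℂ →ₐ[ℂ] ℂ) ≤
        (IsLocalRing.maximalIdeal S).comap s := by
  let c := semiinvariantProduct hu hw
  have hvc : aeval v (c : MvPolynomial σ ℂ) = aeval v (monomial w (1 : ℂ)) := by
    rw [coe_semiinvariantProduct, map_mul, hvu, one_mul]
  have hc : c ∈ (pointIdeal a v).primeCompl := fun h => hvw (hvc ▸ mem_pointIdeal.1 h)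
  have hunit : IsUnit (algebraMap _ S c) :=
    IsLocalization.map_units S (⟨c, hc⟩ : (pointIdeal a v).primeCompl)
  let q (i : σ) : S := algebraMap _ S (balancedInvariant hu hw i) *
    ↑(hunit.pow (a i).toNat).unit⁻¹
  have hq (i : σ) : q i * algebraMap _ S c ^ (a i).toNat =
      algebraMap _ S (balancedInvariant hu hw i) := by
    rw [mul_assoc, IsUnit.val_inv_mul, mul_one]
  refine ⟨aeval q, aeval_eq_algebraMap_of_mul_pow_eq hu hw hunit hq, ?_⟩
  rw [ker_aeval_eq_span, Ideal.span_le]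
  rintro _ ⟨i, rfl⟩
  have hmem : balancedInvariant hu hw i - algebraMap ℂ _ (v i) * c ^ (a i).toNat ∈
      pointIdeal a v := by
    rw [mem_pointIdeal, AddSubgroupClass.coe_sub, MulMemClass.coe_mul, coe_balancedInvariant,
      SubmonoidClass.coe_pow, Subalgebra.coe_algebraMap, map_sub, map_mul, map_mul, map_mul,
      map_pow, map_pow, map_pow, hvu, hvc, aeval_X, AlgHom.commutes, one_pow, mul_one]
    exact sub_self _
  have hC : (aeval q : MvPolynomial σ ℂ →ₐ[ℂ] S) (C (v i)) =
      algebraMap _ S (algebraMap ℂ (torusInvariants a) (v i)) :=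
    (AlgHom.commutes (aeval q) (v i)).trans
      (IsScalarTower.algebraMap_apply ℂ (torusInvariants a) S _)
  rw [SetLike.mem_coe, Ideal.mem_comap, map_sub, aeval_X, hC,
    ← Ideal.mul_unit_mem_iff_mem _ (hunit.pow (a i).toNat), sub_mul, hq, ← map_pow, ← map_mul,
    ← map_sub]
  exact (IsLocalization.AtPrime.to_map_mem_maximal_iff S (pointIdeal a v) _).2 hmem

include hu hw in
theorem isRegularLocalRing_of_aeval_monomial_eq_one [Finite σ] {v : σ → ℂ}
    (hvu : aeval v (monomial u (1 : ℂ)) = 1) (hvw : aeval v (monomial w (1 : ℂ)) ≠ 0) {i : σ}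
    (hi : v i ≠ 0) (hai : a i ≠ 0) (S : Type*) [CommRing S] [IsLocalRing S] [IsNoetherianRing S]
    [Algebra (torusInvariants a) S] [Algebra ℂ S] [IsScalarTower ℂ (torusInvariants a) S]
    [IsLocalization.AtPrime S (pointIdeal a v)] : IsRegularLocalRing S := by
  refine IsRegularLocalRing.of_spanFinrank_maximalIdeal_le _ ?_
  rw [IsLocalization.AtPrime.ringKrullDim_eq_height (pointIdeal a v) S]
  obtain ⟨s, hs, hker⟩ := exists_local_section hu hw hvu hvw S
  have hle := spanFinrank_maximalIdeal_le_finrank_map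
    (IsLocalization.AtPrime.map_eq_maximalIdeal (pointIdeal a v) S) (gradient a v)
    fun h hh hd => by
      rw [← hs]
      exact Ideal.le_comap_pow _ 2
        (Ideal.pow_right_mono hker 2 (mem_sq_ker_aeval (mem_pointIdeal.1 hh) (congrFun hd)))
  have hheight := (Nat.cast_le.2 (hle.trans_lt (finrank_map_gradient_lt hi hai _))).trans
    (natCard_le_height_pointIdeal_add_one hu hw (hvu.trans_ne one_ne_zero) hvw)
  generalize (IsLocalRing.maximalIdeal S).spanFinrank = n at hheight ⊢
  generalize (pointIdeal a v).height = H at hheight ⊢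
  rw [Nat.succ_eq_add_one, Nat.cast_add, Nat.cast_one,
    ENat.add_le_add_iff_right ENat.one_ne_top] at hheight
  exact_mod_cast hheight

end Balanced

/-- The action of `t` in coordinates. -/
def scalePoint (a : σ → ℤ) (t : ℂˣ) (v : σ → ℂ) : σ → ℂ := fun i => ((t ^ a i : ℂˣ) : ℂ) * v i

theorem scalePoint_ne_zero_iff {t : ℂˣ} {v : σ → ℂ} {i : σ} :
    scalePoint a t v i ≠ 0 ↔ v i ≠ 0 := by
  rw [scalePoint, mul_ne_zero_iff, and_iff_right (Units.ne_zero _)]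

theorem aeval_scalePoint_monomial (t : ℂˣ) (v : σ → ℂ) (d : σ →₀ ℕ) :
    aeval (scalePoint a t v) (monomial d (1 : ℂ)) =
      ((t ^ Finsupp.weight a d : ℂˣ) : ℂ) * aeval v (monomial d (1 : ℂ)) := by
  have hpow : t ^ Finsupp.weight a d = d.prod fun i n => (t ^ a i) ^ n := by
    induction d using Finsupp.induction_linear with
    | zero => simp
    | add d e hd he =>
      rw [map_add, zpow_add, hd, he,
        Finsupp.prod_add_index' (fun _ => pow_zero _) fun _ => pow_add _]
    | single i n =>
      rw [Finsupp.weight_single,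
        Finsupp.prod_single_index (h := fun i n => (t ^ a i) ^ n) (pow_zero _),
        nsmul_eq_mul, mul_comm, zpow_mul, zpow_natCast]
  simp [aeval_monomial, hpow, scalePoint, mul_pow, Finsupp.prod,
    Finset.prod_mul_distrib]

theorem evalPoint_scalePoint (t : ℂˣ) (v : σ → ℂ) :
    evalPoint a (scalePoint a t v) = evalPoint a v := by
  refine AlgHom.toLinearMap_injective (torusInvariants_linearMap_ext fun d => ?_)
  change aeval _ (monomial (d : σ →₀ ℕ) (1 : ℂ)) = aeval _ (monomial (d : σ →₀ ℕ) (1 : ℂ))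
  rw [aeval_scalePoint_monomial, mem_invariantExponents.1 d.2, zpow_zero, Units.val_one, one_mul]

theorem IsStabilizerOrder.exists_semiinvariants {v : σ → ℂ}
    (h : IsStabilizerOrder a {i | v i ≠ 0} 1) :
    ∃ u w : σ →₀ ℕ, Finsupp.weight a u = 1 ∧ Finsupp.weight a w = -1 ∧
      aeval v (monomial u (1 : ℂ)) ≠ 0 ∧ aeval v (monomial w (1 : ℂ)) ≠ 0 := by
  obtain ⟨u, hu, hu1⟩ := (h 1).2 (by simp)
  obtain ⟨w, hw, hw1⟩ := (h (-1)).2 (by simp)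
  exact ⟨u, w, hu1, hw1, aeval_monomial_ne_zero hu, aeval_monomial_ne_zero hw⟩

theorem evalPoint_notMem_singularLocus [Finite σ] {v : σ → ℂ}
    (h : IsStabilizerOrder a {i | v i ≠ 0} 1) :
    evalPoint a v ∉ singularLocus (torusInvariants a) := by
  obtain ⟨u, w, hu, hw, hvu, hvw⟩ := h.exists_semiinvariants
  obtain ⟨i, hi, hai⟩ := h.exists_pos one_ne_zero
  let t : ℂˣ := (Units.mk0 _ hvu)⁻¹
  have htu : aeval (scalePoint a t v) (monomial u (1 : ℂ)) = 1 := by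
    rw [aeval_scalePoint_monomial, hu, zpow_one]
    exact inv_mul_cancel₀ hvu
  have htw : aeval (scalePoint a t v) (monomial w (1 : ℂ)) ≠ 0 := by
    rw [aeval_scalePoint_monomial]
    exact mul_ne_zero (Units.ne_zero _) hvw
  rw [← evalPoint_scalePoint t v]
  exact not_not.2 (isRegularLocalRing_of_aeval_monomial_eq_one hu hw htu htw
    (scalePoint_ne_zero_iff.2 hi) hai.ne' (Localization.AtPrime (pointIdeal a _)))

end RegularPoints

/-! ### Euclidean topology and free orbits -/

section EuclideanTopology

variable {A : Type*} [CommRing A] [Algebra ℂ A]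

theorem ComplexPoints.isInducing_eval :
    Topology.IsInducing fun (x : ComplexPoints A) (h : A) => x.eval h := ⟨rfl⟩

theorem ComplexPoints.continuous_eval (h : A) :
    Continuous (ComplexPoints.eval h : ComplexPoints A → ℂ) :=
  (continuous_apply h).comp isInducing_eval.continuous

theorem ComplexPoints.continuous_iff {X : Type*} [TopologicalSpace X] {f : X → ComplexPoints A} :
    Continuous f ↔ ∀ h : A, Continuous fun x => (f x).eval h :=
  isInducing_eval.continuous_iff.trans continuous_pi_iff

theorem ComplexPoints.isInducing_of_span_eq_top {ι : Type*} {m : ι → A}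
    (hm : Submodule.span ℂ (Set.range m) = ⊤) :
    Topology.IsInducing fun (x : ComplexPoints A) (i : ι) => x.eval (m i) := by
  have hsurj (h : A) : ∃ c : ι →₀ ℂ, Finsupp.linearCombination ℂ m c = h := by
    rw [← LinearMap.mem_range, Finsupp.range_linearCombination, hm]
    exact Submodule.mem_top
  choose c hc using hsurj
  refine .of_comp (g := fun y h => ∑ i ∈ (c h).support, c h i * y i)
    (continuous_pi fun i => continuous_eval (m i)) (by fun_prop) ?_
  convert isInducing_eval (A := A) using 1
  funext x h
  let ψ : A →ₐ[ℂ] ℂ := x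
  change ∑ i ∈ (c h).support, c h i * ψ (m i) = ψ h
  conv_rhs => rw [← hc h]
  simp [Finsupp.linearCombination_apply, Finsupp.sum]

/-- The points at which the values of the functions `m i`, for `i ∈ F`, differ by less than `ε i`
from those at `x₀`. -/
def ComplexPoints.polydisc {ι : Type*} (m : ι → A) (x₀ : ComplexPoints A) (F : Set ι) (ε : ι → ℝ) :
    Set (ComplexPoints A) :=
  {x | ∀ i ∈ F, ‖x.eval (m i) - x₀.eval (m i)‖ < ε i}

theorem ComplexPoints.isOpen_polydisc {ι : Type*} (m : ι → A) (x₀ : ComplexPoints A) {F : Set ι}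
    (hF : F.Finite) (ε : ι → ℝ) : IsOpen (polydisc m x₀ F ε) := by
  simp only [polydisc, Set.ofPred_forall]
  exact hF.isOpen_biInter fun i _ =>
    isOpen_lt ((continuous_eval _).sub continuous_const).norm continuous_const

theorem ComplexPoints.mem_polydisc_self {ι : Type*} (m : ι → A) (x₀ : ComplexPoints A) (F : Set ι)
    {ε : ι → ℝ} (hε : ∀ i, 0 < ε i) : x₀ ∈ polydisc m x₀ F ε := fun i _ => by
  simpa using hε i

theorem ComplexPoints.exists_polydisc_subset {ι : Type*} {m : ι → A}
    (hm : Submodule.span ℂ (Set.range m) = ⊤) {x₀ : ComplexPoints A} {U : Set (ComplexPoints A)}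
    (hU : U ∈ nhds x₀) :
    ∃ (F : Set ι) (ε : ι → ℝ), F.Finite ∧ (∀ i, 0 < ε i) ∧ polydisc m x₀ F ε ⊆ U := by
  rw [(isInducing_of_span_eq_top hm).nhds_eq_comap, nhds_pi, Filter.mem_comap] at hU
  obtain ⟨V, hV, hVU⟩ := hU
  obtain ⟨F, hF, t, ht, htV⟩ := Filter.mem_pi.1 hV
  choose ε hε hεt using fun i => Metric.mem_nhds_iff.1 (ht i)
  exact ⟨F, ε, hF, hε, fun x hx => hVU (htV fun i hi => hεt i (mem_ball_iff_norm.2 (hx i hi)))⟩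

end EuclideanTopology

theorem exists_continuousOn_subtype {X Y : Type*} [TopologicalSpace X] [TopologicalSpace Y]
    {f : X → Y} {O : Set X} {T : Set Y} (hf : ContinuousOn f O) (hfT : Set.MapsTo f O T) (y₀ : T) :
    ∃ g : X → T, ContinuousOn g O ∧ ∀ x ∈ O, (g x : Y) = f x := by
  classical
  have hg (x : X) (hx : x ∈ O) :
      ((if h : f x ∈ T then ⟨f x, h⟩ else y₀ : T) : Y) = f x := by rw [dif_pos (hfT hx)]
  exact ⟨_, Topology.IsInducing.subtypeVal.continuousOn_iff.2 (hf.congr hg), hg⟩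

section Orbits

open MvPolynomial

variable {σ : Type*} {a : σ → ℤ}

theorem continuous_evalPoint : Continuous (evalPoint a) := by
  refine ComplexPoints.continuous_iff.2 fun h => ?_
  simp only [eval_evalPoint, aeval_eq_eval]
  exact MvPolynomial.continuous_eval _

theorem scalePoint_scalePoint (s t : ℂˣ) (v : σ → ℂ) :
    scalePoint a s (scalePoint a t v) = scalePoint a (s * t) v := by
  funext i
  simp only [scalePoint, mul_zpow, Units.val_mul, mul_assoc]

theorem scalePoint_one (v : σ → ℂ) : scalePoint a 1 v = v := by
  funext i
  simp [scalePoint]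

theorem continuous_scalePoint (t : ℂˣ) : Continuous (scalePoint a t) :=
  continuous_pi fun i => continuous_const.mul (continuous_apply i)

theorem joinedIn_scalePoint {T : Set (σ → ℂ)} {v : σ → ℂ} (hT : ∀ t, scalePoint a t v ∈ T)
    (t : ℂˣ) : JoinedIn T v (scalePoint a t v) := by
  let θ (r : ℝ) : ℂˣ :=
    Units.mk0 (Complex.exp (r * Complex.log t)) (Complex.exp_ne_zero _)
  have hθ0 : θ 0 = 1 := Units.ext (by simp [θ])
  have hθ1 : θ 1 = t := Units.ext (by simp [θ, Complex.exp_log])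
  refine JoinedIn.ofLine (f := fun r => scalePoint a (θ r) v) ?_ ?_ ?_
    (Set.image_subset_iff.2 fun r _ => hT _)
  · refine continuousOn_pi.2 fun i => ?_
    simp only [scalePoint, θ, Units.val_zpow_eq_zpow_val, Units.val_mk0, ← Complex.exp_int_mul]
    fun_prop
  · rw [hθ0, scalePoint_one]
  · rw [hθ1]

section OrbitSection

variable {u w : σ →₀ ℕ} (hu : Finsupp.weight a u = 1) (hw : Finsupp.weight a w = -1)

/-- Over the locus where the product of the semi-invariant monomials with exponents `u` and `w`
does not vanish, this regular map picks the point of each orbit at which the first of the two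
monomials takes the value `1`. -/
def orbitSection (x : ComplexPoints (torusInvariants a)) : σ → ℂ := fun i =>
  x.eval (balancedInvariant hu hw i) / x.eval (semiinvariantProduct hu hw) ^ (a i).toNat

theorem continuousOn_orbitSection :
    ContinuousOn (orbitSection hu hw) {x | x.eval (semiinvariantProduct hu hw) ≠ 0} :=
  continuousOn_pi.2 fun _ => (ComplexPoints.continuous_eval _).continuousOn.div
    ((ComplexPoints.continuous_eval _).pow _).continuousOn fun _ hx => pow_ne_zero _ hx

theorem orbitSection_evalPoint {v : σ → ℂ} {τ : ℂˣ} (hτ : aeval v (monomial u (1 : ℂ)) = τ)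
    (hvw : aeval v (monomial w (1 : ℂ)) ≠ 0) :
    orbitSection hu hw (evalPoint a v) = scalePoint a τ⁻¹ v := by
  funext i
  have hpow : (τ : ℂ) ^ (-a i).toNat = ((τ⁻¹ ^ a i : ℂˣ) : ℂ) * (τ : ℂ) ^ (a i).toNat := by
    have h : τ ^ (-a i).toNat = τ⁻¹ ^ a i * τ ^ (a i).toNat := by
      rw [← zpow_natCast, ← zpow_natCast, inv_zpow, ← zpow_neg, ← zpow_add]
      congr 1
      omega
    exact_mod_cast congrArg Units.val h
  simp only [orbitSection, eval_evalPoint, coe_balancedInvariant, coe_semiinvariantProduct,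
    scalePoint, map_mul, map_pow, aeval_X, hτ]
  rw [div_eq_iff (pow_ne_zero _ (mul_ne_zero τ.ne_zero hvw)), mul_pow, hpow]
  ring

theorem eval_semiinvariantProduct_ne_zero_iff {v : σ → ℂ} :
    (evalPoint a v).eval (semiinvariantProduct hu hw) ≠ 0 ↔
      aeval v (monomial u (1 : ℂ)) ≠ 0 ∧ aeval v (monomial w (1 : ℂ)) ≠ 0 := by
  rw [eval_evalPoint, coe_semiinvariantProduct, map_mul, mul_ne_zero_iff]

theorem exists_scalePoint_eq_orbitSection {v : σ → ℂ}
    (hv : (evalPoint a v).eval (semiinvariantProduct hu hw) ≠ 0) :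
    ∃ t : ℂˣ, scalePoint a t v = orbitSection hu hw (evalPoint a v) := by
  obtain ⟨hvu, hvw⟩ := (eval_semiinvariantProduct_ne_zero_iff hu hw).1 hv
  exact ⟨(Units.mk0 _ hvu)⁻¹, (orbitSection_evalPoint hu hw rfl hvw).symm⟩

end OrbitSection

/-- The points with trivial stabilizer and closed orbit. -/
def freeLocus (a : σ → ℤ) : Set (σ → ℂ) := {v | IsStabilizerOrder a {i | v i ≠ 0} 1}

theorem scalePoint_mem_freeLocus {t : ℂˣ} {v : σ → ℂ} (hv : v ∈ freeLocus a) :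
    scalePoint a t v ∈ freeLocus a := by
  simpa only [freeLocus, Set.mem_ofPred_eq, scalePoint_ne_zero_iff] using hv

theorem scalePoint_mem_preimage_inter_freeLocus {U : Set (ComplexPoints (torusInvariants a))}
    {v : σ → ℂ} (hv : v ∈ evalPoint a ⁻¹' U ∩ freeLocus a) (t : ℂˣ) :
    scalePoint a t v ∈ evalPoint a ⁻¹' U ∩ freeLocus a :=
  ⟨by rw [Set.mem_preimage, evalPoint_scalePoint]; exact hv.1, scalePoint_mem_freeLocus hv.2⟩

theorem exists_scalePoint_eq_of_evalPoint_eq {v v' : σ → ℂ} (hv : v ∈ freeLocus a)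
    (h : evalPoint a v = evalPoint a v') : ∃ t : ℂˣ, scalePoint a t v = v' := by
  obtain ⟨u, w, hu, hw, hvu, hvw⟩ := IsStabilizerOrder.exists_semiinvariants hv
  have hne := (eval_semiinvariantProduct_ne_zero_iff hu hw).2 ⟨hvu, hvw⟩
  obtain ⟨t, ht⟩ := exists_scalePoint_eq_orbitSection hu hw hne
  obtain ⟨t', ht'⟩ := exists_scalePoint_eq_orbitSection hu hw (h ▸ hne)
  exact ⟨t'⁻¹ * t, by
    rw [← scalePoint_scalePoint, ht, h, ← ht', scalePoint_scalePoint, inv_mul_cancel,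
      scalePoint_one]⟩

/-- The restriction of the quotient map to the free points over `U`, whose images are assumed to
avoid `R`. -/
def freeQuotientMap {R : Set (ComplexPoints (torusInvariants a))}
    (hR : ∀ v ∈ freeLocus a, evalPoint a v ∉ R) (U : Set (ComplexPoints (torusInvariants a))) :
    ↥(evalPoint a ⁻¹' U ∩ freeLocus a) → ↥(U \ R) :=
  fun v => ⟨evalPoint a v, v.2.1, hR _ v.2.2⟩

section FreeQuotientMap

variable {R U : Set (ComplexPoints (torusInvariants a))}
  (hR : ∀ v ∈ freeLocus a, evalPoint a v ∉ R)

theorem continuous_freeQuotientMap : Continuous (freeQuotientMap hR U) :=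
  (continuous_evalPoint.comp continuous_subtype_val).subtype_mk _

theorem freeQuotientMap_surjective (hsurj : ∀ x ∉ R, ∃ v ∈ freeLocus a, evalPoint a v = x) :
    Function.Surjective (freeQuotientMap hR U) := by
  rintro ⟨y, hyU, hyR⟩
  obtain ⟨v, hv, rfl⟩ := hsurj y hyR
  exact ⟨⟨v, hyU, hv⟩, rfl⟩

theorem joinedIn_fiber_freeQuotientMap {e e' : ↥(evalPoint a ⁻¹' U ∩ freeLocus a)}
    (h : freeQuotientMap hR U e = freeQuotientMap hR U e') :
    JoinedIn (freeQuotientMap hR U ⁻¹' {freeQuotientMap hR U e}) e e' := by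
  obtain ⟨t, ht⟩ := exists_scalePoint_eq_of_evalPoint_eq e.2.2 (congrArg Subtype.val h)
  let T := freeQuotientMap hR U ⁻¹' {freeQuotientMap hR U e}
  have hT (s : ℂˣ) : scalePoint a s e ∈ Subtype.val '' T :=
    ⟨⟨_, scalePoint_mem_preimage_inter_freeLocus e.2 s⟩, Subtype.ext (evalPoint_scalePoint s _),
      rfl⟩
  exact (Topology.IsInducing.subtypeVal.joinedIn_image (F := T) rfl h.symm).1
    (ht ▸ joinedIn_scalePoint hT t)

theorem hasLocalSections_freeQuotientMap
    (hsurj : ∀ x ∉ R, ∃ v ∈ freeLocus a, evalPoint a v = x) :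
    HasLocalSections (freeQuotientMap hR U) := by
  intro b
  obtain ⟨v, rfl⟩ := freeQuotientMap_surjective hR hsurj b
  obtain ⟨u, w, hu, hw, hvu, hvw⟩ := IsStabilizerOrder.exists_semiinvariants v.2.2
  let N : Set (ComplexPoints (torusInvariants a)) :=
    {x | x.eval (semiinvariantProduct hu hw) ≠ 0}
  have hN : IsOpen N := isOpen_ne_fun (ComplexPoints.continuous_eval _) continuous_const
  refine ⟨Subtype.val ⁻¹' N, (hN.preimage continuous_subtype_val).mem_nhds
    ((eval_semiinvariantProduct_ne_zero_iff hu hw).2 ⟨hvu, hvw⟩), fun e he => ?_⟩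
  obtain ⟨τ, hτ⟩ := exists_scalePoint_eq_orbitSection hu hw he
  let s₀ (y : ↥(U \ R)) : σ → ℂ := scalePoint a τ⁻¹ (orbitSection hu hw y)
  have hs₀_cont : ContinuousOn s₀ (Subtype.val ⁻¹' N) :=
    (continuous_scalePoint _).comp_continuousOn ((continuousOn_orbitSection hu hw).comp
      continuous_subtype_val.continuousOn fun _ hy => hy)
  have hs₀ (y : ↥(U \ R)) (hy : y.1 ∈ N) :
      s₀ y ∈ evalPoint a ⁻¹' U ∩ freeLocus a ∧ evalPoint a (s₀ y) = y := by
    obtain ⟨v', rfl⟩ := freeQuotientMap_surjective hR hsurj y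
    obtain ⟨t, ht⟩ := exists_scalePoint_eq_orbitSection hu hw hy
    have hs₀v : s₀ (freeQuotientMap hR U v') = scalePoint a (τ⁻¹ * t) v' := by
      rw [← scalePoint_scalePoint, ht]
      rfl
    rw [hs₀v, evalPoint_scalePoint]
    exact ⟨scalePoint_mem_preimage_inter_freeLocus v'.2 _, rfl⟩
  obtain ⟨s, hs_cont, hs⟩ :=
    exists_continuousOn_subtype hs₀_cont (fun y hy => (hs₀ y hy).1) e
  refine ⟨s, hs_cont, fun y hy => Subtype.ext ?_, Subtype.ext ?_⟩
  · exact (congrArg (evalPoint a) (hs y hy)).trans (hs₀ y hy).2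
  · rw [hs _ he]
    change scalePoint a τ⁻¹ (orbitSection hu hw (evalPoint a e)) = e
    rw [← hτ, scalePoint_scalePoint, inv_mul_cancel, scalePoint_one]

include hR in
theorem simplyConnectedSpace_diff (hsurj : ∀ x ∉ R, ∃ v ∈ freeLocus a, evalPoint a v = x)
    [SimplyConnectedSpace ↥(evalPoint a ⁻¹' U ∩ freeLocus a)] :
    SimplyConnectedSpace ↥(U \ R) :=
  (hasLocalSections_freeQuotientMap hR hsurj).simplyConnectedSpace
    (continuous_freeQuotientMap hR) (freeQuotientMap_surjective hR hsurj)
    fun _ _ => joinedIn_fiber_freeQuotientMap hR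

end FreeQuotientMap

end Orbits

section FreeLocus

open MvPolynomial

variable {σ : Type*} {a : σ → ℤ}

variable (a) in
/-- The maximal supports of the points outside `freeLocus a`: those without positive weights, those
without negative weights, and those on which all weights are divisible by some `k ≠ 1`. -/
def nonfreeSupports : Set (Set σ) :=
  {S | S = {i | a i ≤ 0} ∨ S = {i | 0 ≤ a i} ∨ ∃ k : ℕ, k ≠ 1 ∧ S = {i | (k : ℤ) ∣ a i}}

theorem mem_freeLocus_iff [Finite σ] {v : σ → ℂ} :
    v ∈ freeLocus a ↔ ∀ S ∈ nonfreeSupports a, v ∉ Pi.spanSubset ℂ S := by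
  simp only [Pi.mem_spanSubset_iff]
  constructor
  · rintro hv S (rfl | rfl | ⟨k, hk, rfl⟩) hS
    · obtain ⟨i, hi, hai⟩ := IsStabilizerOrder.exists_pos hv one_ne_zero
      exact hi (hS i hai.not_ge)
    · obtain ⟨i, hi, hai⟩ := IsStabilizerOrder.exists_neg hv one_ne_zero
      exact hi (hS i hai.not_ge)
    · obtain ⟨u, hu, hw⟩ := (hv 1).2 (one_dvd 1)
      have hdvd : (k : ℤ) ∣ Finsupp.weight a u := Finset.dvd_sum fun i hi =>
        dvd_nsmul_of_dvd _ (not_imp_comm.1 (hS i) (hu hi))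
      rw [hw] at hdvd
      exact hk (by exact_mod_cast Int.eq_one_of_dvd_one (by positivity) hdvd)
  · intro h
    have hpos := h _ (Or.inl rfl)
    have hneg := h _ (Or.inr (Or.inl rfl))
    simp only [Set.mem_ofPred_eq, not_le, not_forall] at hpos hneg
    obtain ⟨i, hi, hvi⟩ := hpos
    obtain ⟨j, hj, hvj⟩ := hneg
    obtain ⟨k, hk⟩ := exists_isStabilizerOrder (a := a) (I := {i | v i ≠ 0})
      ⟨i, hvi, hi⟩ ⟨j, hvj, hj⟩
    obtain rfl : k = 1 := by
      by_contra hk1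
      exact h _ (Or.inr (Or.inr ⟨k, hk1, rfl⟩)) fun l hl => not_imp_comm.1 hk.dvd hl
    exact hk

theorem apply_eq_zero_of_weight_eq_zero {I : Set σ}
    (hI : (∀ i ∈ I, a i ≤ 0) ∨ ∀ i ∈ I, 0 ≤ a i) {d : σ →₀ ℕ} (hd : d ∈ Finsupp.supported ℕ ℕ I)
    (hw : Finsupp.weight a d = 0) {i : σ} (hi : i ∈ d.support) : a i = 0 := by
  have hterm : d i • a i = 0 := by
    rcases hI with h | h
    · exact (Finset.sum_eq_zero_iff_of_nonpos fun j hj => nsmul_nonpos (h j (hd hj)) _).1 hw i hi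
    · exact (Finset.sum_eq_zero_iff_of_nonneg fun j hj => nsmul_nonneg (h j (hd hj)) _).1 hw i hi
  exact (smul_eq_zero.1 hterm).resolve_left (Finsupp.mem_support_iff.1 hi)

theorem evalPoint_indicator {v : σ → ℂ}
    (hv : (∀ i, v i ≠ 0 → a i ≤ 0) ∨ ∀ i, v i ≠ 0 → 0 ≤ a i) :
    evalPoint a (Set.indicator {i | a i = 0} v) = evalPoint a v := by
  refine AlgHom.toLinearMap_injective (torusInvariants_linearMap_ext fun d => ?_)
  change aeval _ (monomial (d : σ →₀ ℕ) (1 : ℂ)) = aeval _ (monomial (d : σ →₀ ℕ) (1 : ℂ))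
  rw [aeval_monomial, aeval_monomial]
  congr 1
  by_cases hd : (d : σ →₀ ℕ) ∈ Finsupp.supported ℕ ℕ {i | v i ≠ 0}
  · refine Finset.prod_congr rfl fun i hi => congrArg (· ^ (d : σ →₀ ℕ) i) ?_
    exact Set.indicator_of_mem (s := {i | a i = 0})
      (apply_eq_zero_of_weight_eq_zero hv hd (mem_invariantExponents.1 d.2) hi) v
  · obtain ⟨i, hi, hvi⟩ := Set.not_subset.1 hd
    have hvi : v i = 0 := not_not.1 hvi
    have hdi := Finsupp.mem_support_iff.1 hi
    rw [Finsupp.prod, Finsupp.prod, Finset.prod_eq_zero hi, Finset.prod_eq_zero hi]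
    · rw [hvi, zero_pow hdi]
    · rw [Set.indicator_apply_eq_zero.2 fun _ => hvi, zero_pow hdi]

theorem norm_aeval_smul_monomial_sub_le (d : σ →₀ ℕ) (v : σ → ℂ) {r : ℝ} (hr0 : 0 ≤ r)
    (hr1 : r ≤ 1) :
    ‖aeval (r • v) (monomial d (1 : ℂ)) - aeval (0 : σ → ℂ) (monomial d (1 : ℂ))‖ ≤
      ‖aeval v (monomial d (1 : ℂ)) - aeval (0 : σ → ℂ) (monomial d (1 : ℂ))‖ := by
  simp only [aeval_monomial, map_one, one_mul, Finsupp.prod, Pi.smul_apply, Pi.zero_apply]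
  rcases d.support.eq_empty_or_nonempty with hd | ⟨i, hi⟩
  · simp [hd]
  · have hzero : ∏ j ∈ d.support, (0 : ℂ) ^ d j = 0 :=
      Finset.prod_eq_zero hi (zero_pow (Finsupp.mem_support_iff.1 hi))
    rw [hzero, sub_zero, sub_zero, norm_prod, norm_prod]
    refine Finset.prod_le_prod (fun _ _ => norm_nonneg _) fun j _ => ?_
    rw [norm_pow, norm_pow, norm_smul, Real.norm_of_nonneg hr0]
    exact pow_le_pow_left₀ (by positivity) (mul_le_of_le_one_left (norm_nonneg _) hr1) _

theorem starConvex_preimage_polydisc (F : Set (invariantExponents a))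
    (ε : invariantExponents a → ℝ) :
    StarConvex ℝ 0
      (evalPoint a ⁻¹' ComplexPoints.polydisc invariantMonomial (evalPoint a 0) F ε) := by
  rw [starConvex_zero_iff]
  exact fun v hv r hr0 hr1 d hd =>
    (norm_aeval_smul_monomial_sub_le (d : σ →₀ ℕ) v hr0 hr1).trans_lt (hv d hd)

theorem finrank_spanSubset_add_two_le [Finite σ] {S : Set σ} {i j : σ} (hij : i ≠ j) (hi : i ∉ S)
    (hj : j ∉ S) : Module.finrank ℂ (Pi.spanSubset ℂ S) + 2 ≤ Module.finrank ℂ (σ → ℂ) := by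
  have := Fintype.ofFinite σ
  have hcompl : 1 < Sᶜ.ncard := (Set.one_lt_ncard (Set.toFinite _)).2 ⟨i, hi, j, hj, hij⟩
  rw [Pi.dim_spanSubset, Module.finrank_fintype_fun_eq_card, Fintype.card_eq_nat_card,
    ← Set.ncard_add_ncard_compl S]
  omega

section TwoPairs

variable [Finite σ] {α₁ α₂ β₁ β₂ : σ} (hα : α₁ ≠ α₂) (hβ : β₁ ≠ β₂) (hα₁ : a α₁ = 1)
  (hα₂ : a α₂ = 1) (hβ₁ : a β₁ = -1) (hβ₂ : a β₂ = -1)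

include hα hβ hα₁ hα₂ hβ₁ hβ₂

theorem evalPoint_zero_mem_singularLocus : evalPoint a 0 ∈ singularLocus (torusInvariants a) :=
  evalPoint_mem_singularLocus_of_isStabilizerOrder hα hβ hα₁ hα₂ hβ₁ hβ₂
    (isStabilizerOrder_zero fun _ hi => absurd rfl hi) zero_ne_one

theorem exists_mem_freeLocus_of_notMem_singularLocus {x : ComplexPoints (torusInvariants a)}
    (hx : x ∉ singularLocus (torusInvariants a)) : ∃ v ∈ freeLocus a, evalPoint a v = x := by
  have hstab {v : σ → ℂ} {k : ℕ} (hk : IsStabilizerOrder a {i | v i ≠ 0} k)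
      (hv : evalPoint a v = x) : k = 1 := by
    by_contra hk1
    exact hx (hv ▸ evalPoint_mem_singularLocus_of_isStabilizerOrder hα hβ hα₁ hα₂ hβ₁ hβ₂ hk hk1)
  obtain ⟨v, hv⟩ := evalPoint_surjective x
  by_cases hmix : (∃ i ∈ {i | v i ≠ 0}, 0 < a i) ∧ ∃ i ∈ {i | v i ≠ 0}, a i < 0
  · obtain ⟨k, hk⟩ := exists_isStabilizerOrder hmix.1 hmix.2
    obtain rfl := hstab hk hv
    exact ⟨v, hk, hv⟩
  · have hsign : (∀ i, v i ≠ 0 → a i ≤ 0) ∨ ∀ i, v i ≠ 0 → 0 ≤ a i := by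
      by_contra! h
      exact hmix h
    have hfixed : IsStabilizerOrder a {i | Set.indicator {i | a i = 0} v i ≠ 0} 0 :=
      isStabilizerOrder_zero fun _ hi =>
        Set.mem_of_indicator_ne_zero (s := {i | a i = 0}) hi
    exact absurd (hstab hfixed ((evalPoint_indicator hsign).trans hv)) zero_ne_one

theorem finrank_spanSubset_add_three_le {S : Set σ} (hS : S ∈ nonfreeSupports a) :
    Module.finrank ℝ ((Pi.spanSubset ℂ S).restrictScalars ℝ) + 3 ≤
      Module.finrank ℝ (σ → ℂ) := by
  have h : Module.finrank ℂ (Pi.spanSubset ℂ S) + 2 ≤ Module.finrank ℂ (σ → ℂ) := by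
    rcases hS with rfl | rfl | ⟨k, hk, rfl⟩
    · exact finrank_spanSubset_add_two_le hα (by simp [hα₁]) (by simp [hα₂])
    · exact finrank_spanSubset_add_two_le hβ (by simp [hβ₁]) (by simp [hβ₂])
    · have hk' : ¬ (k : ℤ) ∣ 1 := fun h =>
        hk (by exact_mod_cast Int.eq_one_of_dvd_one (by positivity) h)
      exact finrank_spanSubset_add_two_le hα (by simpa [hα₁] using hk') (by simpa [hα₂] using hk')
  have hreal : Module.finrank ℝ ((Pi.spanSubset ℂ S).restrictScalars ℝ) =
      2 * Module.finrank ℂ (Pi.spanSubset ℂ S) := finrank_real_of_complex (Pi.spanSubset ℂ S)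
  rw [hreal, finrank_real_of_complex (σ → ℂ)]
  omega

theorem simplyConnectedSpace_inter_freeLocus {Ω : Set (σ → ℂ)} (hΩ : IsOpen Ω)
    (hstar : StarConvex ℝ 0 Ω) (h0 : 0 ∈ Ω) : SimplyConnectedSpace ↥(Ω ∩ freeLocus a) := by
  have := Fintype.ofFinite σ
  let L (S : nonfreeSupports a) : Submodule ℝ (σ → ℂ) :=
    (Pi.spanSubset ℂ (S : Set σ)).restrictScalars ℝ
  have heq : Ω ∩ freeLocus a = Ω \ ⋃ S, (L S : Set (σ → ℂ)) := by
    ext v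
    simp only [Set.mem_inter_iff, mem_freeLocus_iff, Set.mem_sdiff, Set.mem_iUnion, not_exists,
      Subtype.forall, L, SetLike.mem_coe, Submodule.restrictScalars_mem]
  rw [heq]
  refine simplyConnectedSpace_starConvex_diff
    (fun S => finrank_spanSubset_add_three_le hα hβ hα₁ hα₂ hβ₁ hβ₂ S.2) hΩ hstar h0 ?_
  exact hΩ.sdiff (isClosed_iUnion_of_finite fun S => (L S).closed_of_finiteDimensional)

theorem exists_isOpen_simplyConnectedSpace_diff_singularLocus
    {U : Set (ComplexPoints (torusInvariants a))} (hU : U ∈ nhds (evalPoint a 0)) :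
    ∃ U' ⊆ U, IsOpen U' ∧ evalPoint a 0 ∈ U' ∧
      SimplyConnectedSpace ↥(U' \ singularLocus (torusInvariants a)) := by
  obtain ⟨F, ε, hF, hε, hFU⟩ :=
    ComplexPoints.exists_polydisc_subset span_range_invariantMonomial hU
  have hopen := ComplexPoints.isOpen_polydisc invariantMonomial (evalPoint a 0) hF ε
  have hmem := ComplexPoints.mem_polydisc_self invariantMonomial (evalPoint a 0) F hε
  have := simplyConnectedSpace_inter_freeLocus hα hβ hα₁ hα₂ hβ₁ hβ₂
    (hopen.preimage continuous_evalPoint) (starConvex_preimage_polydisc F ε) hmem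
  exact ⟨_, hFU, hopen, hmem,
    simplyConnectedSpace_diff (fun _ hv => evalPoint_notMem_singularLocus hv) fun _ hx =>
      exists_mem_freeLocus_of_notMem_singularLocus hα hβ hα₁ hα₂ hβ₁ hβ₂ hx⟩

end TwoPairs

end FreeLocus

/-! ### Weights of an algebraic representation -/

section Weights

variable {V : Type*} [AddCommGroup V] [Module ℂ V] {ρ : Representation ℂ ℂˣ V}

theorem mem_weightSpace {m : ℤ} {v : V} :
    v ∈ weightSpace ρ m ↔ ∀ t : ℂˣ, ρ t v = ((t ^ m : ℂˣ) : ℂ) • v := by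
  simp [weightSpace, Submodule.mem_iInf, LinearMap.mem_eqLocus]

theorem eval₂_id_eq_sum (P : LaurentPolynomial ℂ) {M : Finset ℤ} (hM : P.coeff.support ⊆ M)
    (t : ℂˣ) :
    LaurentPolynomial.eval₂ (RingHom.id ℂ) t P = ∑ m ∈ M, P.coeff m * ((t ^ m : ℂˣ) : ℂ) := by
  rw [← Finsupp.sum_of_support_subset P.coeff hM (fun m c => c * ((t ^ m : ℂˣ) : ℂ)) (by simp)]
  clear hM
  induction P using LaurentPolynomial.induction_on' with
  | add p q hp hq =>
    rw [map_add, hp, hq, AddMonoidAlgebra.coeff_add,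
      Finsupp.sum_add_index' (by simp) (by simp [add_mul])]
  | C_mul_T n c =>
    rw [LaurentPolynomial.eval₂_C_mul_T, ← LaurentPolynomial.single_eq_C_mul_T,
      AddMonoidAlgebra.coeff_single, Finsupp.sum_single_index (by simp), RingHom.id_apply]

theorem two_zpow_injective : Function.Injective fun m : ℤ =>
    ((Units.mk0 (2 : ℂ) two_ne_zero ^ m : ℂˣ) : ℂ) := by
  intro m n h
  simp only [Units.val_zpow_eq_zpow_val, Units.val_mk0] at h
  have h_norm := congrArg norm h
  rw [norm_zpow, norm_zpow, Complex.norm_ofNat] at h_norm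
  exact zpow_right_injective₀ (by norm_num) (by norm_num) h_norm

theorem linearIndependent_zpow :
    LinearIndependent ℂ fun (m : ℤ) (t : ℂˣ) => ((t ^ m : ℂˣ) : ℂ) := by
  let χ (m : ℤ) : ℂˣ →* ℂ := (Units.coeHom ℂ).comp (zpowGroupHom m)
  have hχ : Function.Injective χ := fun m n hmn =>
    two_zpow_injective (DFunLike.congr_fun hmn (Units.mk0 (2 : ℂ) two_ne_zero))
  exact (linearIndependent_monoidHom ℂˣ ℂ).comp χ hχ

theorem eq_of_sum_zpow_smul_eq {M : Finset ℤ} {x y : ℤ → V}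
    (h : ∀ t : ℂˣ, ∑ m ∈ M, ((t ^ m : ℂˣ) : ℂ) • x m = ∑ m ∈ M, ((t ^ m : ℂˣ) : ℂ) • y m) :
    ∀ m ∈ M, x m = y m := by
  intro m hm
  rw [← sub_eq_zero, ← Module.forall_dual_apply_eq_zero_iff ℂ]
  intro φ
  refine linearIndependent_iff'.1 linearIndependent_zpow M (fun m => φ (x m - y m)) ?_ m hm
  funext t
  have hφ := congrArg φ (h t)
  simp only [map_sum, map_smul, smul_eq_mul] at hφ
  simp only [Finset.sum_apply, Pi.smul_apply, Pi.zero_apply, smul_eq_mul, map_sub, sub_mul,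
    Finset.sum_sub_distrib, mul_comm (φ _), hφ, sub_self]

theorem IsAlgebraicRep.exists_eq_sum [FiniteDimensional ℂ V] (hρ : IsAlgebraicRep ρ) (v : V) :
    ∃ (M : Finset ℤ) (w : ℤ → V), ∀ t, ρ t v = ∑ m ∈ M, ((t ^ m : ℂˣ) : ℂ) • w m := by
  classical
  let e := Module.finBasis ℂ V
  choose P hP using fun j => hρ (e.coord j) v
  let M : Finset ℤ := Finset.univ.biUnion fun j => (P j).coeff.support
  refine ⟨M, fun m => ∑ j, (P j).coeff m • e j, fun t => ?_⟩
  have h_repr (j) : e.repr (ρ t v) j = ∑ m ∈ M, (P j).coeff m * ((t ^ m : ℂˣ) : ℂ) :=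
    (hP j t).trans (eval₂_id_eq_sum _ (Finset.subset_biUnion_of_mem
      (fun j => (P j).coeff.support) (Finset.mem_univ j)) t)
  rw [← e.sum_repr (ρ t v)]
  simp only [h_repr, Finset.sum_smul, Finset.smul_sum, smul_smul]
  rw [Finset.sum_comm]
  simp only [mul_comm]

theorem mem_weightSpace_of_forall_eq_sum {v : V} {M : Finset ℤ} {w : ℤ → V}
    (h : ∀ t, ρ t v = ∑ m ∈ M, ((t ^ m : ℂˣ) : ℂ) • w m) {m : ℤ} (hm : m ∈ M) :
    w m ∈ weightSpace ρ m := by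
  refine mem_weightSpace.2 fun s => eq_of_sum_zpow_smul_eq (x := fun m => ρ s (w m))
    (y := fun m => ((s ^ m : ℂˣ) : ℂ) • w m) (fun t => ?_) m hm
  have h_mul : ρ s (ρ t v) = ρ (t * s) v := by
    rw [mul_comm, map_mul, Module.End.mul_apply]
  rw [h t, h (t * s)] at h_mul
  simpa only [map_sum, map_smul, mul_zpow, Units.val_mul, mul_smul] using h_mul

theorem iSup_weightSpace_eq_top [FiniteDimensional ℂ V] (hρ : IsAlgebraicRep ρ) :
    ⨆ m, weightSpace ρ m = ⊤ := by
  refine eq_top_iff.2 fun v _ => ?_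
  obtain ⟨M, w, h⟩ := hρ.exists_eq_sum v
  have hv : v = ∑ m ∈ M, w m := by
    simpa using h 1
  rw [hv]
  exact Submodule.sum_mem _ fun m hm =>
    Submodule.mem_iSup_of_mem m (mem_weightSpace_of_forall_eq_sum h hm)

variable {σ : Type*} {b : Module.Basis σ ℂ V} {a : σ → ℤ}

variable (ρ b a) in
/-- The basis `b` consists of weight vectors, of weights `a`. -/
def IsWeightBasis : Prop := ∀ (t : ℂˣ) (i : σ), ρ t (b i) = ((t ^ a i : ℂˣ) : ℂ) • b i

theorem exists_isWeightBasis [FiniteDimensional ℂ V] (hρ : IsAlgebraicRep ρ) :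
    ∃ (n : ℕ) (b : Module.Basis (Fin n) ℂ V) (a : Fin n → ℤ), IsWeightBasis ρ b a := by
  let W : Set V := ⋃ m, weightSpace ρ m
  have hW : ⊤ ≤ Submodule.span ℂ W := by
    rw [← iSup_weightSpace_eq_top hρ, Submodule.iSup_eq_span]
  have := Module.Finite.finite_basis (Module.Basis.ofSpan hW)
  obtain ⟨n, ⟨f⟩⟩ :=
    Finite.exists_equiv_fin ((linearIndepOn_empty ℂ id).extend (Set.empty_subset W))
  let b := (Module.Basis.ofSpan hW).reindex f
  have hb (i : Fin n) : ∃ m, b i ∈ weightSpace ρ m := by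
    refine Set.mem_iUnion.1 (?_ : b i ∈ W)
    rw [Module.Basis.reindex_apply]
    exact Module.Basis.ofSpan_subset hW ⟨_, rfl⟩
  choose a ha using hb
  exact ⟨n, b, a, fun t i => mem_weightSpace.1 (ha i) t⟩

theorem IsWeightBasis.repr_apply (hb : IsWeightBasis ρ b a) (t : ℂˣ) (v : V) (i : σ) :
    b.repr (ρ t v) i = ((t ^ a i : ℂˣ) : ℂ) * b.repr v i := by
  classical
  have h : b.coord i ∘ₗ ρ t = ((t ^ a i : ℂˣ) : ℂ) • b.coord i := b.ext fun j => by
    rw [LinearMap.comp_apply, hb, map_smul, LinearMap.smul_apply]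
    by_cases hij : j = i <;> simp [hij]
  exact LinearMap.congr_fun h v

theorem IsWeightBasis.weightSpace_le_span (hb : IsWeightBasis ρ b a) (m : ℤ) :
    weightSpace ρ m ≤ Submodule.span ℂ (b '' {i | a i = m}) := by
  intro v hv
  rw [Module.Basis.mem_span_image]
  intro i hi
  refine two_zpow_injective (mul_right_cancel₀ (Finsupp.mem_support_iff.1 hi) ?_)
  rw [← hb.repr_apply, mem_weightSpace.1 hv, map_smul, Finsupp.smul_apply, smul_eq_mul]

theorem IsWeightBasis.exists_ne_of_two_le_finrank [Finite σ] (hb : IsWeightBasis ρ b a) {m : ℤ}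
    (hm : 2 ≤ Module.finrank ℂ (weightSpace ρ m)) : ∃ i j, i ≠ j ∧ a i = m ∧ a j = m := by
  have := b.finiteDimensional_of_finite
  have h_card : 1 < {i | a i = m}.ncard :=
    calc 1 < Module.finrank ℂ (weightSpace ρ m) := hm
      _ ≤ Module.finrank ℂ (Submodule.span ℂ (b '' {i | a i = m})) :=
        Submodule.finrank_mono (hb.weightSpace_le_span m)
      _ ≤ (b '' {i | a i = m}).ncard := by
        have := Fintype.ofFinite (b '' {i | a i = m})
        rw [Set.ncard_eq_toFinset_card']
        exact finrank_span_le_card _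
      _ ≤ {i | a i = m}.ncard := Set.ncard_image_le
  obtain ⟨i, hi, j, hj, hij⟩ := (Set.one_lt_ncard (Set.toFinite _)).1 h_card
  exact ⟨i, j, hij, hi, hj⟩

end Weights

section Transport

theorem isRegularLocalRing_atPrime_comap_iff {A B : Type*} [CommRing A] [CommRing B] (e : A ≃+* B)
    (q : Ideal B) [q.IsPrime] : IsRegularLocalRing (Localization.AtPrime (q.comap e)) ↔
      IsRegularLocalRing (Localization.AtPrime q) := by
  let f := IsLocalization.ringEquivOfRingEquiv (Localization.AtPrime (q.comap e))
    (Localization.AtPrime q) e (e.map_primeCompl_comap_eq q)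
  exact ⟨fun _ => .of_ringEquiv f, fun _ => .of_ringEquiv f.symm⟩

variable {A B : Type*} [CommRing A] [Algebra ℂ A] [CommRing B] [Algebra ℂ B]

/-- The homeomorphism between spaces of complex points induced by an isomorphism of algebras. -/
def ComplexPoints.homeomorph (e : A ≃ₐ[ℂ] B) : ComplexPoints B ≃ₜ ComplexPoints A where
  toFun y := (show B →ₐ[ℂ] ℂ from y).comp (e : A →ₐ[ℂ] B)
  invFun x := (show A →ₐ[ℂ] ℂ from x).comp (e.symm : B →ₐ[ℂ] A)
  left_inv y := AlgHom.ext fun h => congrArg (show B →ₐ[ℂ] ℂ from y) (e.apply_symm_apply h)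
  right_inv x := AlgHom.ext fun h => congrArg (show A →ₐ[ℂ] ℂ from x) (e.symm_apply_apply h)
  continuous_toFun := ComplexPoints.continuous_iff.2 fun h => ComplexPoints.continuous_eval (e h)
  continuous_invFun := ComplexPoints.continuous_iff.2 fun h =>
    ComplexPoints.continuous_eval (e.symm h)

theorem ComplexPoints.homeomorph_mem_singularLocus_iff (e : A ≃ₐ[ℂ] B) {y : ComplexPoints B} :
    ComplexPoints.homeomorph e y ∈ singularLocus A ↔ y ∈ singularLocus B :=
  not_congr (isRegularLocalRing_atPrime_comap_iff e.toRingEquiv y.toPrimeSpectrum.asIdeal)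

theorem ComplexPoints.preimage_homeomorph_singularLocus (e : A ≃ₐ[ℂ] B) :
    ComplexPoints.homeomorph e ⁻¹' singularLocus A = singularLocus B :=
  Set.ext fun _ => homeomorph_mem_singularLocus_iff e

theorem exists_isConnected_simplyConnectedSpace_diff_of_algEquiv (e : A ≃ₐ[ℂ] B)
    {y₀ : ComplexPoints B}
    (h : ∀ U ∈ nhds y₀, ∃ U' ⊆ U, IsOpen U' ∧ y₀ ∈ U' ∧
      SimplyConnectedSpace ↥(U' \ singularLocus B)) {U : Set (ComplexPoints A)}
    (hU : U ∈ nhds (ComplexPoints.homeomorph e y₀)) :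
    ∃ U' ⊆ U, IsOpen U' ∧ ComplexPoints.homeomorph e y₀ ∈ U' ∧
      IsConnected (U' \ singularLocus A) ∧ SimplyConnectedSpace ↥(U' \ singularLocus A) := by
  let Φ := ComplexPoints.homeomorph e
  obtain ⟨U', hU', hopen, hy₀, hsc⟩ := h (Φ ⁻¹' U) (Φ.continuous.continuousAt hU)
  have h_preimage : U' \ singularLocus B = Φ ⁻¹' (Φ '' U' \ singularLocus A) := by
    rw [Set.preimage_sdiff, Φ.preimage_image, ComplexPoints.preimage_homeomorph_singularLocus]
  have hsc' : SimplyConnectedSpace ↥(Φ '' U' \ singularLocus A) :=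
    (Φ.sets h_preimage).symm.toHomotopyEquiv.simplyConnectedSpace
  exact ⟨Φ '' U', Set.image_subset_iff.2 hU', Φ.isOpenMap _ hopen, ⟨_, hy₀, rfl⟩,
    isConnected_iff_connectedSpace.2 inferInstance, hsc'⟩

end Transport

section Coordinates

open MvPolynomial

variable {V : Type*} [AddCommGroup V] [Module ℂ V] {σ : Type*} {ρ : Representation ℂ ℂˣ V}
  {a : σ → ℤ}

/-- The action of `t` on polynomials in coordinates of weights `a`. It is contragredient, whence the
inverse. -/
def scaleHom (a : σ → ℤ) (t : ℂˣ) : MvPolynomial σ ℂ →ₐ[ℂ] MvPolynomial σ ℂ :=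
  aeval fun i => ((t⁻¹ ^ a i : ℂˣ) : ℂ) • X i

theorem scaleHom_monomial (t : ℂˣ) (d : σ →₀ ℕ) : scaleHom a t (monomial d 1) =
    ((t⁻¹ ^ Finsupp.weight a d : ℂˣ) : ℂ) • monomial d 1 := by
  induction d using Finsupp.induction_linear with
  | zero => simp
  | add d e hd he =>
    have h_add : (monomial (d + e) 1 : MvPolynomial σ ℂ) = monomial d 1 * monomial e 1 := by
      simp [monomial_mul]
    rw [h_add, map_mul, hd, he, map_add, zpow_add, Units.val_mul, smul_mul_smul_comm]
  | single i n =>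
    rw [← X_pow_eq_monomial, map_pow, scaleHom, aeval_X, smul_pow, Finsupp.weight_apply,
      Finsupp.sum_single_index (by simp), nsmul_eq_mul, mul_comm, zpow_mul, zpow_natCast,
      Units.val_pow_eq_pow_val]

theorem coeff_scaleHom (t : ℂˣ) (h : MvPolynomial σ ℂ) (d : σ →₀ ℕ) :
    coeff d (scaleHom a t h) = ((t⁻¹ ^ Finsupp.weight a d : ℂˣ) : ℂ) * coeff d h := by
  classical
  have h_eq : lcoeff ℂ d ∘ₗ (scaleHom a t).toLinearMap =
      ((t⁻¹ ^ Finsupp.weight a d : ℂˣ) : ℂ) • lcoeff ℂ d := by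
    refine (basisMonomials σ ℂ).ext fun e => ?_
    simp only [coe_basisMonomials, LinearMap.comp_apply, AlgHom.toLinearMap_apply,
      LinearMap.smul_apply, lcoeff_apply, scaleHom_monomial, coeff_smul, coeff_monomial]
    by_cases hed : e = d <;> simp [hed]
  exact LinearMap.congr_fun h_eq h

theorem forall_scaleHom_eq_iff {h : MvPolynomial σ ℂ} :
    (∀ t, scaleHom a t h = h) ↔ h ∈ torusInvariants a := by
  rw [mem_torusInvariants]
  constructor
  · intro hh d hd
    have h_coeff := congrArg (coeff d) (hh (Units.mk0 (2 : ℂ) two_ne_zero)⁻¹)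
    rw [coeff_scaleHom, inv_inv, mul_eq_right₀ hd] at h_coeff
    exact two_zpow_injective (h_coeff.trans (by simp))
  · intro hh t
    ext d
    rw [coeff_scaleHom]
    by_cases hd : coeff d h = 0
    · rw [hd, mul_zero]
    · simp [hh hd]

theorem mem_invariantRing {h : SymmetricAlgebra ℂ (Module.Dual ℂ V)} :
    h ∈ invariantRing ρ ↔ ∀ t, symAction ρ t h = h := by
  simp [invariantRing, Algebra.mem_iInf]

variable [Finite σ] [DecidableEq σ]

/-- The isomorphism from the polynomial functions on `V` to the polynomials in the coordinates with
respect to a basis. -/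
def coordinateEquiv (b : Module.Basis σ ℂ V) :
    SymmetricAlgebra ℂ (Module.Dual ℂ V) ≃ₐ[ℂ] MvPolynomial σ ℂ :=
  SymmetricAlgebra.equivMvPolynomial b.dualBasis

theorem coordinateEquiv_ι (b : Module.Basis σ ℂ V) (i : σ) :
    coordinateEquiv b (SymmetricAlgebra.ι ℂ _ (b.dualBasis i)) = X i :=
  SymmetricAlgebra.equivMvPolynomial_ι_apply _ _

theorem aeval_zero_coordinateEquiv (b : Module.Basis σ ℂ V)
    (h : SymmetricAlgebra ℂ (Module.Dual ℂ V)) :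
    aeval (0 : σ → ℂ) (coordinateEquiv b h) = evalAt (0 : V) h := by
  have h_eq : (aeval (0 : σ → ℂ)).comp (coordinateEquiv b : _ →ₐ[ℂ] MvPolynomial σ ℂ) =
      evalAt (0 : V) := by
    refine SymmetricAlgebra.algHom_ext (b.dualBasis.ext fun i => ?_)
    change aeval (0 : σ → ℂ) (coordinateEquiv b (SymmetricAlgebra.ι ℂ _ (b.dualBasis i))) =
      evalAt (0 : V) (SymmetricAlgebra.ι ℂ _ (b.dualBasis i))
    rw [coordinateEquiv_ι, aeval_X, evalAt, SymmetricAlgebra.lift_ι_apply]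
    simp
  exact DFunLike.congr_fun h_eq h

variable {b : Module.Basis σ ℂ V} (hb : IsWeightBasis ρ b a)

include hb

theorem IsWeightBasis.dual_dualBasis (t : ℂˣ) (i : σ) :
    ρ.dual t (b.dualBasis i) = ((t⁻¹ ^ a i : ℂˣ) : ℂ) • b.dualBasis i := by
  refine b.ext fun j => ?_
  change b.dualBasis i (ρ t⁻¹ (b j)) = ((t⁻¹ ^ a i : ℂˣ) : ℂ) • b.dualBasis i (b j)
  rw [hb, map_smul, Module.Basis.dualBasis_apply_self]
  by_cases h : j = i <;> simp [h]

theorem IsWeightBasis.coordinateEquiv_symAction (t : ℂˣ)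
    (h : SymmetricAlgebra ℂ (Module.Dual ℂ V)) :
    coordinateEquiv b (symAction ρ t h) = scaleHom a t (coordinateEquiv b h) := by
  have h_eq : (coordinateEquiv b : _ →ₐ[ℂ] MvPolynomial σ ℂ).comp (symAction ρ t) =
      (scaleHom a t).comp (coordinateEquiv b : _ →ₐ[ℂ] _) := by
    refine SymmetricAlgebra.algHom_ext (b.dualBasis.ext fun i => ?_)
    change coordinateEquiv b (symAction ρ t (SymmetricAlgebra.ι ℂ _ (b.dualBasis i))) =
      scaleHom a t (coordinateEquiv b (SymmetricAlgebra.ι ℂ _ (b.dualBasis i)))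
    rw [symAction, SymmetricAlgebra.lift_ι_apply, LinearMap.comp_apply, hb.dual_dualBasis,
      map_smul, map_smul, coordinateEquiv_ι, scaleHom, aeval_X]
  exact DFunLike.congr_fun h_eq h

theorem IsWeightBasis.map_invariantRing :
    (invariantRing ρ).map (coordinateEquiv b : _ →ₐ[ℂ] MvPolynomial σ ℂ) = torusInvariants a := by
  ext h
  rw [Subalgebra.mem_map, ← forall_scaleHom_eq_iff]
  simp only [mem_invariantRing, AlgEquiv.coe_toAlgHom]
  constructor
  · rintro ⟨x, hx, rfl⟩ t
    rw [← hb.coordinateEquiv_symAction, hx t]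
  · intro hh
    refine ⟨(coordinateEquiv b).symm h, fun t => (coordinateEquiv b).injective ?_,
      (coordinateEquiv b).apply_symm_apply h⟩
    rw [hb.coordinateEquiv_symAction, AlgEquiv.apply_symm_apply, hh]

/-- The invariants of a representation of `ℂˣ` in the coordinates with respect to a basis of weight
vectors. -/
def invariantRingEquiv : invariantRing ρ ≃ₐ[ℂ] torusInvariants a :=
  ((coordinateEquiv b).subalgebraMap (invariantRing ρ)).trans
    (Subalgebra.equivOfEq _ _ hb.map_invariantRing)

theorem homeomorph_evalPoint_zero :
    ComplexPoints.homeomorph (invariantRingEquiv hb) (evalPoint a 0) = quotientMap ρ 0 :=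
  AlgHom.ext fun h => aeval_zero_coordinateEquiv b h.1

end Coordinates

end GITQuotient

end

theorem mainTheorem8 {V : Type*} [AddCommGroup V] [Module ℂ V] [FiniteDimensional ℂ V]
    (ρ : Representation ℂ ℂˣ V) (hρ : GITQuotient.IsAlgebraicRep ρ)
    (hneg : 2 ≤ Module.finrank ℂ (GITQuotient.weightSpace ρ (-1)))
    (hpos : 2 ≤ Module.finrank ℂ (GITQuotient.weightSpace ρ 1)) :
    GITQuotient.quotientMap ρ 0 ∈
        GITQuotient.singularLocus (GITQuotient.invariantRing ρ) ∧
      ∀ U ∈ nhds (GITQuotient.quotientMap ρ 0),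
        ∃ U' : Set (GITQuotient.AffineQuotient ρ), U' ⊆ U ∧ IsOpen U' ∧
          GITQuotient.quotientMap ρ 0 ∈ U' ∧
          IsConnected (U' \ GITQuotient.singularLocus (GITQuotient.invariantRing ρ)) ∧
          SimplyConnectedSpace
            ↥(U' \ GITQuotient.singularLocus (GITQuotient.invariantRing ρ)) := by
  obtain ⟨n, b, a, hb⟩ := GITQuotient.exists_isWeightBasis hρ
  obtain ⟨α₁, α₂, hα, hα₁, hα₂⟩ := hb.exists_ne_of_two_le_finrank hpos
  obtain ⟨β₁, β₂, hβ, hβ₁, hβ₂⟩ := hb.exists_ne_of_two_le_finrank hneg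
  rw [← GITQuotient.homeomorph_evalPoint_zero hb]
  constructor
  · rw [GITQuotient.ComplexPoints.homeomorph_mem_singularLocus_iff]
    exact GITQuotient.evalPoint_zero_mem_singularLocus hα hβ hα₁ hα₂ hβ₁ hβ₂
  · intro U hU
    refine GITQuotient.exists_isConnected_simplyConnectedSpace_diff_of_algEquiv _ ?_ hU
    exact fun U hU => GITQuotient.exists_isOpen_simplyConnectedSpace_diff_singularLocus
      hα hβ hα₁ hα₂ hβ₁ hβ₂ hU
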